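/- Let $2\le m_1\le m_2$ be integers, $\Sigma_{m}=\{0,1,\dots,m-1\}$, and let $A\subseteq\Sigma_{m_1}\times\Sigma_{m_2}$ be nonempty, contained neither in the last column $\{m_1-1\}\times\Sigma_{m_2}$ nor in the last row $\Sigma_{m_1}\times\{m_2-1\}$. Let $$K=\Big\{\Big(\sum_{n\ge1}\frac{a^{(1)}_n}{m_1^{n}},\ \sum_{n\ge1}\frac{a^{(2)}_n}{m_2^{n}}\Big):\ (a^{(1)}_n,a^{(2)}_n)\in A\ \text{for all } n\ge1\Big\}\subseteq[0,1]^2$$ be the Bedford–McMullen carpet determined by $A$. Let $M=\#\{a^{(1)}:(a^{(1)},a^{(2)})\in A\}$ be the number of nonempty columns, and suppose that every nonempty column contains the same number $N$ of chosen rectangles, that is, $\#\{j:(i,j)\in A\}=N$ for each $i$ for which this set is nonempty (when $m_1<m_2$ this means exactly that the box and Hausdorff dimensions of $K$ coincide). For an integer $m\ge 2$ let $T_{m}(x)=mx\ (\mathrm{mod}\ 1)\in[0,1)$. Let $\psi:\mathbb N\to(0,\infty)$ and let $W(K,T,\psi)$ be the set of all $x=(x^{(1)},x^{(2)})\in K$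 such that, for infinitely many $n$, $$|x^{(1)}-T_{m_1}^n x^{(1)}|<\psi(n)\quad\text{and}\quad |x^{(2)}-T_{m_2}^n x^{(2)}|<\psi(n).$$ Put $\tau_i=\liminf_{n\to\infty}\frac{-\log_{m_i}\psi(n)}{n}\in[-\infty,\infty]$ for $i=1,2$, and assume $\tau_1\ge0$ (the value $\tau_1=\infty$ is allowed, with $\frac{c}{1+\infty}=0$). (1) If $\log_{m_1}m_2>1+\tau_1$, then $$\dim_{\mathrm H}W(K,T,\psi)=\min\Big\{\frac{\log_{m_1}M+\log_{m_2}N}{1+\tau_2},\ \frac{\log_{m_1}M}{1+\tau_1}+\log_{m_2}N\Big\}.$$ (2) If $\log_{m_1}m_2\le1+\tau_1$, then $$\dim_{\mathrm H}W(K,T,\psi)=\min\Big\{\frac{\log_{m_1}M+\log_{m_2}N}{1+\tau_2},\ \frac{\log_{m_1}M+\log_{m_1}N}{1+\tau_1}\Big\}.$$ -/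

import Mathlib

open Set Filter Topology
open scoped ENNReal

noncomputable section

namespace BedfordMcMullen

variable {m₁ m₂ : ℕ}

/-- The coding map `(Σ_{m₁} × Σ_{m₂})^ℕ → [0,1]²`: the `i`-th coordinate of the image is the real
number whose base-`mᵢ` digits after the point are the `i`-th coordinates of the sequence, that is
`∑_{n ≥ 1} xₙ⁽ⁱ⁾ / mᵢⁿ`. -/
def coding (x : ℕ → Fin m₁ × Fin m₂) : ℝ × ℝ :=
  (Real.ofDigits fun n => (x n).1, Real.ofDigits fun n => (x n).2)

/-- The Bedford–McMullen carpet `K = π(A^ℕ)` determined by the alphabet `A`. It is a subset of the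
plane, here `ℝ × ℝ` with the maximum metric (which is bi-Lipschitz equivalent to the Euclidean one,
so that Hausdorff dimensions are the same). -/
def carpet (A : Finset (Fin m₁ × Fin m₂)) : Set (ℝ × ℝ) :=
  coding '' {x | ∀ n, x n ∈ A}

/-- The digits of the nonempty columns. -/
def columns (A : Finset (Fin m₁ × Fin m₂)) : Finset (Fin m₁) :=
  A.image Prod.fst

/-- The number of rectangles chosen from the column `i`. -/
def columnCount (A : Finset (Fin m₁ × Fin m₂)) (i : Fin m₁) : ℕ :=
  (A.filter fun a => a.1 = i).card

/-- The map `T_m x = m x (mod 1)`, with values in `[0,1)`. -/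
def timesMod (m : ℕ) (x : ℝ) : ℝ := Int.fract (m * x)

/-- The recurrent set `W(K,T,ψ)`: the points of `K` whose coordinates both return to within `ψ n`
after `n` steps, for infinitely many `n`. -/
def recurrentSet (A : Finset (Fin m₁ × Fin m₂)) (ψ : ℕ → ℝ) : Set (ℝ × ℝ) :=
  {x | x ∈ carpet A ∧ ∃ᶠ n in atTop,
    |x.1 - (timesMod m₁)^[n] x.1| < ψ n ∧ |x.2 - (timesMod m₂)^[n] x.2| < ψ n}

/-- `liminf_{n → ∞} (-log_m ψ(n)) / n`, as an extended real number. -/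
def decayRate (m : ℕ) (ψ : ℕ → ℝ) : EReal :=
  liminf (fun n : ℕ => ((-Real.logb m (ψ n) / n : ℝ) : EReal)) atTop

end BedfordMcMullen

end

namespace BedfordMcMullen

/-! ### Digit expansions -/

/-! Write α = log m₁, β = log m₂, and let l be the natural decay rate of ψ, so that τ₁ = l/α and τ₂
= l/β. As all nonempty columns have N cells, K is coded by two unconstrained sequences: u over M
letters for the columns and v over N letters for the cells inside them (`exists_parametrization`).
For finite l the dimension is the least of (log M · β/α + log N)/(β + l), log M/(α + l) + log N/β
and (log M + log N)/(α + l) (`dimH_recurrentSet_eq`). Comparing β with α + l decides between the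
last two and gives the two cases.

Upper bound: points with the same first n symbols that return within e^{-ln} at time n lie in
boundedly many rectangles with sides of order e^{-(α+l)n} and e^{-(β+l)n}, because the difference
between the n-th iterate and the identity expands by m_i^n - 1. There are (MN)^n such symbol words.
One square of the larger side per rectangle gives the third value; when α + l ≤ β such a square
swallows many rectangles at once, which gives the second; cutting each rectangle into squares of the
smaller side gives the first. `dimH_limsup_le` converts the counts into dimensions.

Lower bound: along a very sparse sequence of times n with ψ(n) ≥ e^{-ln}, force the digits after
position n to repeat the initial ones, for about nl/α places in u and nl/β places in v, and choose
all other digits independently and uniformly. The image measure gives a ball of radius e^{-t} mass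
about exp(-(log M · F₁ + log N · F₂)), where F₁ and F₂ count the free places among the first t/α and
t/β (`le_dimH_of_freeCount`). This exponent is piecewise linear in t up to small errors, and its
comparison with s t reduces to the three upper bounds (`mul_le_of_vertices`). -/

/-- The integer whose base-`b` digits are the first `k` terms of `d`. -/
def prefixValue {b : ℕ} (d : ℕ → Fin b) : ℕ → ℤ
  | 0 => 0
  | k + 1 => b * prefixValue d k + (d k : ℕ)

theorem prefixValue_congr {b : ℕ} {d d' : ℕ → Fin b} {k : ℕ} (h : ∀ i < k, d i = d' i) :
    prefixValue d k = prefixValue d' k := by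
  induction k with
  | zero => rfl
  | succ k ih =>
    simp only [prefixValue]
    rw [ih fun i hi => h i (by omega), h k (by omega)]

theorem eq_of_prefixValue_eq {b : ℕ} {d d' : ℕ → Fin b} {k : ℕ}
    (h : prefixValue d k = prefixValue d' k) : ∀ i < k, d i = d' i := by
  induction k with
  | zero => intro i hi; omega
  | succ k ih =>
    simp only [prefixValue] at h
    have h1 : ((d k : ℕ) : ℤ) = (d' k : ℕ) := by
      have := congrArg (· % (b : ℤ)) h
      simp only [Int.mul_add_emod_self_left] at this
      rwa [Int.emod_eq_of_lt (by positivity) (by exact_mod_cast (d k).2),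
        Int.emod_eq_of_lt (by positivity) (by exact_mod_cast (d' k).2)] at this
    have hb : (b : ℤ) ≠ 0 := by
      have := (d k).2
      omega
    have h2 : prefixValue d k = prefixValue d' k := by
      rw [h1] at h
      exact mul_left_cancel₀ hb (by linarith)
    intro i hi
    rcases Nat.lt_succ_iff_lt_or_eq.mp hi with hi | rfl
    · exact ih h2 i hi
    · exact Fin.ext (by exact_mod_cast h1)

theorem mul_ofDigits {b : ℕ} (d : ℕ → Fin b) :
    b * Real.ofDigits d = (d 0 : ℕ) + Real.ofDigits (fun i => d (i + 1)) := by
  have hb : (b : ℝ) ≠ 0 := by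
    have := (d 0).2
    norm_cast; omega
  rw [Real.ofDigits_eq_sum_add_ofDigits d 1]
  simp only [Finset.sum_range_one, Real.ofDigitsTerm]
  field_simp
  ring_nf

theorem pow_mul_ofDigits {b : ℕ} (d : ℕ → Fin b) (k : ℕ) :
    (b : ℝ) ^ k * Real.ofDigits d = prefixValue d k + Real.ofDigits (fun i => d (i + k)) := by
  induction k with
  | zero => simp [prefixValue]
  | succ k ih =>
    rw [pow_succ', mul_assoc, ih, mul_add, mul_ofDigits]
    simp only [prefixValue, zero_add]
    push_cast
    have : (fun i => d (i + 1 + k)) = fun i => d (i + (k + 1)) := by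
      funext i; congr 1; ring
    rw [this]; ring

theorem iterate_timesMod (b : ℕ) (x : ℝ) {n : ℕ} (hn : 1 ≤ n) :
    (timesMod b)^[n] x = Int.fract ((b : ℝ) ^ n * x) := by
  induction n, hn using Nat.le_induction with
  | base => simp [timesMod]
  | succ n hn ih =>
    rw [Function.iterate_succ_apply', ih, timesMod, Int.fract_eq_fract]
    refine ⟨-(b * ⌊(b : ℝ) ^ n * x⌋), ?_⟩
    rw [Int.fract]
    push_cast
    ring

-- A tail of value 1 has fractional part 0. This jump is why the coverings below also record whether
-- the tail equals 1, and why the lower bound needs a digit other than the last one.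
open Classical in
theorem iterate_timesMod_ofDigits {b : ℕ} (d : ℕ → Fin b) {n : ℕ} (hn : 1 ≤ n) :
    (timesMod b)^[n] (Real.ofDigits d) =
      Real.ofDigits (fun i => d (i + n)) - if Real.ofDigits (fun i => d (i + n)) = 1 then 1 else 0 := by
  rw [iterate_timesMod b _ hn, pow_mul_ofDigits, Int.fract_intCast_add]
  split_ifs with h
  · simp [h]
  · rw [Int.fract_eq_self.mpr, sub_zero]
    exact ⟨Real.ofDigits_nonneg _, lt_of_le_of_ne (Real.ofDigits_le_one _) h⟩

/-- With a common prefix and the same correction term, subtracting the two return errors leaves (b^n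
- 1)(x - x'), and b^n - 1 ≥ b^n/2. -/
theorem abs_ofDigits_sub_le_of_return {b : ℕ} (hb : 2 ≤ b) {d d' : ℕ → Fin b} {n : ℕ} (hn : 1 ≤ n)
    {r : ℝ} (h : ∀ i < n, d i = d' i)
    (h1 : Real.ofDigits (fun i => d (i + n)) = 1 ↔ Real.ofDigits (fun i => d' (i + n)) = 1)
    (hd : |Real.ofDigits d - (timesMod b)^[n] (Real.ofDigits d)| ≤ r)
    (hd' : |Real.ofDigits d' - (timesMod b)^[n] (Real.ofDigits d')| ≤ r) :
    |Real.ofDigits d - Real.ofDigits d'| ≤ 4 * r / (b : ℝ) ^ n := by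
  classical
  rw [iterate_timesMod_ofDigits d hn] at hd
  rw [iterate_timesMod_ofDigits d' hn] at hd'
  have e1 := pow_mul_ofDigits d n
  have e2 := pow_mul_ofDigits d' n
  rw [prefixValue_congr h] at e1
  have hpow : (2 : ℝ) ≤ (b : ℝ) ^ n := by
    calc (2 : ℝ) ≤ b := by exact_mod_cast hb
      _ = (b : ℝ) ^ 1 := (pow_one _).symm
      _ ≤ (b : ℝ) ^ n := pow_le_pow_right₀ (by norm_cast; omega) hn
  simp only [h1] at hd
  set x := Real.ofDigits d
  set x' := Real.ofDigits d'
  set c : ℝ := if Real.ofDigits (fun i => d' (i + n)) = 1 then 1 else 0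
  have key : |((b : ℝ) ^ n - 1) * (x - x')| ≤ 2 * r := by
    rw [abs_le] at *
    constructor <;> nlinarith
  rw [abs_mul, abs_of_nonneg (by linarith)] at key
  rw [le_div_iff₀ (by linarith)]
  nlinarith [abs_nonneg (x - x')]

theorem abs_ofDigits_sub_le_of_prefixValue_eq {b : ℕ} {d d' : ℕ → Fin b} {k q : ℕ}
    (h : prefixValue d k = prefixValue d' k) (hq : ∀ i < q, d (i + k) = d' (i + k)) :
    |Real.ofDigits d - Real.ofDigits d'| ≤ ((b : ℝ) ^ (k + q))⁻¹ := by
  refine Real.abs_ofDigits_sub_ofDigits_le fun i hi => ?_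
  rcases lt_or_ge i k with hik | hik
  · exact eq_of_prefixValue_eq h i hik
  · have := hq (i - k) (by omega)
    rwa [Nat.sub_add_cancel hik] at this

/-! ### Dimension of limsup sets -/

/-- Covering argument of Borel–Cantelli type: for s > P/R the sums of the s-th powers of the
diameters converge geometrically. The pieces at level n are the fibres of `g` on `S n`. -/
theorem dimH_limsup_le {X Ω : Type*} [MetricSpace X] (f : Ω → X) (S : ℕ → Set Ω) {C P R : ℝ}
    (hC : 0 < C) (hP : 0 ≤ P) (hR : 0 < R)
    (h : ∀ n : ℕ, 1 ≤ n → ∃ (ι : Type) (_ : Fintype ι) (g : Ω → ι),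
      (Fintype.card ι : ℝ) ≤ C * Real.exp (P * n) ∧
      ∀ ω ∈ S n, ∀ ω' ∈ S n, g ω = g ω' → dist (f ω) (f ω') ≤ C * Real.exp (-R * n)) :
    dimH {x | ∃ᶠ n in atTop, x ∈ f '' S n} ≤ ENNReal.ofReal (P / R) := by
  let _ : MeasurableSpace X := borel X
  have : BorelSpace X := ⟨rfl⟩
  have h' : ∀ n : ℕ, ∃ (ι : Type) (_ : Fintype ι) (g : Ω → ι),
      (Fintype.card ι : ℝ) ≤ C * Real.exp (P * (n + 1 : ℕ)) ∧
      ∀ ω ∈ S (n + 1), ∀ ω' ∈ S (n + 1), g ω = g ω' →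
        dist (f ω) (f ω') ≤ C * Real.exp (-R * (n + 1 : ℕ)) := fun n => h (n + 1) (by omega)
  choose ι hι g hcard hg using h'
  refine le_of_forall_gt fun a ha => ?_
  obtain ⟨s, hs1, hs2⟩ := ENNReal.lt_iff_exists_nnreal_btwn.mp ha
  refine lt_of_le_of_lt ?_ hs2
  refine dimH_le_of_hausdorffMeasure_ne_top ?_
  have hPs : P < R * s := by
    have := (ENNReal.ofReal_lt_iff_lt_toReal (by positivity) ENNReal.coe_ne_top).mp hs1
    rw [ENNReal.coe_toReal, div_lt_iff₀ hR] at this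
    linarith
  have hs0 : (0 : ℝ) ≤ s := s.2
  let r : ℕ → ℝ≥0∞ := fun n => ENNReal.ofReal (C * Real.exp (-R * (n + 1 : ℕ)))
  let t : ∀ n : ℕ, (Σ k : ℕ, ι (n + k)) → Set X := fun n p =>
    f '' (S (n + p.1 + 1) ∩ g (n + p.1) ⁻¹' {p.2})
  have hdiam : ∀ n p, Metric.ediam (t n p) ≤ r (n + p.1) := by
    rintro n ⟨k, i⟩
    refine Metric.ediam_le ?_
    rintro _ ⟨ω, ⟨hω, hi⟩, rfl⟩ _ ⟨ω', ⟨hω', hi'⟩, rfl⟩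
    rw [edist_dist]
    exact ENNReal.ofReal_le_ofReal (hg (n + k) ω hω ω' hω' (hi.trans hi'.symm))
  have hranti : Antitone r := by
    intro a b hab
    refine ENNReal.ofReal_le_ofReal ?_
    have : (a : ℝ) ≤ b := by exact_mod_cast hab
    refine mul_le_mul_of_nonneg_left (Real.exp_le_exp.mpr ?_) hC.le
    push_cast
    nlinarith
  have hr : Tendsto r atTop (𝓝 0) := by
    have : Tendsto (fun n : ℕ => C * Real.exp (-R * (n + 1 : ℕ))) atTop (𝓝 (C * 0)) := by
      refine Tendsto.const_mul _ (Real.tendsto_exp_atBot.comp ?_)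
      have h1 : Tendsto (fun n : ℕ => ((n + 1 : ℕ) : ℝ)) atTop atTop :=
        tendsto_natCast_atTop_atTop.comp (tendsto_add_atTop_nat 1)
      exact h1.const_mul_atTop_of_neg (by linarith)
    rw [mul_zero] at this
    simpa only [ENNReal.ofReal_zero] using ENNReal.tendsto_ofReal this
  have hcover : ∀ n, {x | ∃ᶠ n in atTop, x ∈ f '' S n} ⊆ ⋃ i, t n i := by
    intro n x hx
    obtain ⟨j, hj, hxj⟩ := (frequently_atTop.mp hx) (n + 1)
    obtain ⟨k, rfl⟩ := Nat.exists_eq_add_of_le hj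
    obtain ⟨ω, hω, rfl⟩ := hxj
    have e : n + 1 + k = n + k + 1 := by ring
    rw [e] at hω
    exact mem_iUnion.mpr ⟨⟨k, g (n + k) ω⟩, ω, ⟨hω, rfl⟩, rfl⟩
  have hmain := MeasureTheory.Measure.hausdorffMeasure_le_liminf_tsum (s : ℝ)
    {x | ∃ᶠ n in atTop, x ∈ f '' S n} r hr t
    (Eventually.of_forall fun n i => (hdiam n i).trans (hranti (Nat.le_add_right _ _)))
    (Eventually.of_forall hcover)
  let q : ℕ → ℝ := fun n => C * C ^ (s : ℝ) * Real.exp (P - R * s) ^ (n + 1)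
  have hq : Summable q := by
    refine Summable.mul_left _ ?_
    have : Real.exp (P - R * s) < 1 := by rw [Real.exp_lt_one_iff]; linarith
    exact (summable_nat_add_iff 1).mpr
      (summable_geometric_of_lt_one (Real.exp_pos _).le this)
  have hterm : ∀ n, ∑' i, Metric.ediam (t n i) ^ (s : ℝ) ≤ ∑' k, ENNReal.ofReal (q k) := by
    intro n
    rw [ENNReal.tsum_sigma']
    have : ∀ k, ∑' i : ι (n + k), Metric.ediam (t n ⟨k, i⟩) ^ (s : ℝ) ≤
        ENNReal.ofReal (q (n + k)) := by
      intro k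
      rw [tsum_fintype]
      calc ∑ i : ι (n + k), Metric.ediam (t n ⟨k, i⟩) ^ (s : ℝ)
          ≤ ∑ i : ι (n + k), r (n + k) ^ (s : ℝ) :=
            Finset.sum_le_sum fun i _ => ENNReal.rpow_le_rpow (hdiam n ⟨k, i⟩) hs0
        _ = ENNReal.ofReal (Fintype.card (ι (n + k)) *
              (C * Real.exp (-R * (n + k + 1 : ℕ))) ^ (s : ℝ)) := by
            simp only [r, Finset.sum_const, Finset.card_univ, nsmul_eq_mul]
            rw [ENNReal.ofReal_mul (p := (Fintype.card (ι (n + k)) : ℝ)) (by positivity),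
              ENNReal.ofReal_natCast,
              ENNReal.ofReal_rpow_of_nonneg (by positivity) hs0]
        _ ≤ ENNReal.ofReal (q (n + k)) := by
            refine ENNReal.ofReal_le_ofReal ?_
            calc _ ≤ C * Real.exp (P * (n + k + 1 : ℕ)) *
                  (C * Real.exp (-R * (n + k + 1 : ℕ))) ^ (s : ℝ) := by
                  gcongr
                  exact hcard (n + k)
              _ = q (n + k) := by
                  simp only [q]
                  rw [Real.mul_rpow hC.le (Real.exp_pos _).le, ← Real.exp_mul, ← Real.exp_nat_mul]
                  have : ∀ a b c d : ℝ, C * a * (b * c) = C * b * (a * c) := by intros; ring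
                  rw [this _ _ _ 0, ← Real.exp_add]
                  congr 2
                  push_cast
                  ring
    calc _ ≤ ∑' k, ENNReal.ofReal (q (n + k)) := ENNReal.tsum_le_tsum this
      _ ≤ _ := ENNReal.tsum_comp_le_tsum_of_injective (add_right_injective n)
            (fun k => ENNReal.ofReal (q k))
  -- Finite s-dimensional measure suffices, so it is enough to bound every tail by one convergent
  -- series.
  refine ne_top_of_le_ne_top (hq.tsum_ofReal_ne_top) (hmain.trans ?_)
  refine (liminf_le_liminf (Eventually.of_forall hterm)).trans ?_
  simp

/-! ### Parametrization of the carpet -/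

/-- The point of the plane with first digits `c (uₙ)` and second digits `e (uₙ) (vₙ)`. -/
noncomputable def point {m₁ m₂ M N : ℕ} (c : Fin M → Fin m₁) (e : Fin M → Fin N → Fin m₂)
    (ω : (ℕ → Fin M) × (ℕ → Fin N)) : ℝ × ℝ :=
  coding fun n => (c (ω.1 n), e (ω.1 n) (ω.2 n))

/-- Equal column counts allow the cells of every column to be labelled by the same `Fin N`, so the
second sequence of labels does not depend on the first. -/
theorem exists_parametrization {m₁ m₂ : ℕ} (A : Finset (Fin m₁ × Fin m₂)) {M N : ℕ}
    (hM : (columns A).card = M) (hN : ∀ i ∈ columns A, columnCount A i = N) :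
    ∃ (c : Fin M → Fin m₁) (e : Fin M → Fin N → Fin m₂), Function.Injective c ∧
      (∀ i, Function.Injective (e i)) ∧ ∀ a, a ∈ A ↔ ∃ i j, (c i, e i j) = a := by
  let φ := (columns A).equivFinOfCardEq hM
  have hfib : ∀ i : Fin M, (A.filter fun a => a.1 = (φ.symm i : Fin m₁)).card = N :=
    fun i => hN _ (φ.symm i).2
  let χ := fun i : Fin M => Finset.equivFinOfCardEq (hfib i)
  have hχ : ∀ i j, (((χ i).symm j : Fin m₁ × Fin m₂)) ∈ A ∧
      ((χ i).symm j : Fin m₁ × Fin m₂).1 = φ.symm i := fun i j =>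
    Finset.mem_filter.mp ((χ i).symm j).2
  have hpair : ∀ i j, ((φ.symm i : Fin m₁), ((χ i).symm j : Fin m₁ × Fin m₂).2) =
      ((χ i).symm j : Fin m₁ × Fin m₂) := fun i j => Prod.ext (hχ i j).2.symm rfl
  refine ⟨fun i => φ.symm i, fun i j => ((χ i).symm j : Fin m₁ × Fin m₂).2,
    Subtype.val_injective.comp φ.symm.injective, ?_, ?_⟩
  · intro i j j' h
    refine (χ i).symm.injective (Subtype.ext ?_)
    rw [← hpair i j, ← hpair i j']
    exact Prod.ext rfl h
  · intro a
    constructor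
    · intro ha
      have hcol : a.1 ∈ columns A := Finset.mem_image_of_mem _ ha
      let i := φ ⟨a.1, hcol⟩
      have hi : (φ.symm i : Fin m₁) = a.1 := by simp [i]
      refine ⟨i, χ i ⟨a, Finset.mem_filter.mpr ⟨ha, hi.symm⟩⟩, ?_⟩
      rw [hpair]
      simp
    · rintro ⟨i, j, rfl⟩
      rw [hpair]
      exact (hχ i j).1

theorem carpet_eq_range {m₁ m₂ M N : ℕ} {A : Finset (Fin m₁ × Fin m₂)} {c : Fin M → Fin m₁}
    {e : Fin M → Fin N → Fin m₂} (h : ∀ a, a ∈ A ↔ ∃ i j, (c i, e i j) = a) :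
    carpet A = range (point c e) := by
  ext x
  constructor
  · rintro ⟨y, hy, rfl⟩
    choose u v huv using fun n => (h (y n)).mp (hy n)
    exact ⟨(u, v), congrArg coding (funext huv)⟩
  · rintro ⟨ω, rfl⟩
    exact ⟨_, fun n => (h _).mpr ⟨_, _, rfl⟩, rfl⟩

/-- The sequences whose image returns to within `r` after `n` steps, in both coordinates. -/
def returnSet {m₁ m₂ M N : ℕ} (c : Fin M → Fin m₁) (e : Fin M → Fin N → Fin m₂) (r : ℝ) (n : ℕ) :
    Set ((ℕ → Fin M) × (ℕ → Fin N)) :=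
  {ω | |(point c e ω).1 - (timesMod m₁)^[n] (point c e ω).1| ≤ r ∧
    |(point c e ω).2 - (timesMod m₂)^[n] (point c e ω).2| ≤ r}

theorem pow_eq_exp {m : ℕ} (hm : 0 < m) (k : ℕ) : (m : ℝ) ^ k = Real.exp (Real.log m * k) := by
  rw [mul_comm, Real.exp_nat_mul, Real.exp_log (by exact_mod_cast hm)]

/-! ### Upper bounds -/

section Upper

variable {m₁ m₂ M N : ℕ} {c : Fin M → Fin m₁} {e : Fin M → Fin N → Fin m₂}

theorem abs_point_fst_sub_le (hm₁ : 2 ≤ m₁) {r : ℝ} {n : ℕ} (hn : 1 ≤ n)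
    {ω ω' : (ℕ → Fin M) × (ℕ → Fin N)} (hω : ω ∈ returnSet c e r n) (hω' : ω' ∈ returnSet c e r n)
    (hu : ∀ i < n, ω.1 i = ω'.1 i)
    (h1 : Real.ofDigits (fun i => c (ω.1 (i + n))) = 1 ↔
      Real.ofDigits (fun i => c (ω'.1 (i + n))) = 1) :
    |(point c e ω).1 - (point c e ω').1| ≤ 4 * r / (m₁ : ℝ) ^ n :=
  abs_ofDigits_sub_le_of_return hm₁ hn (fun i hi => congrArg c (hu i hi)) h1 hω.1 hω'.1

theorem abs_point_snd_sub_le (hm₂ : 2 ≤ m₂) {r : ℝ} {n : ℕ} (hn : 1 ≤ n)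
    {ω ω' : (ℕ → Fin M) × (ℕ → Fin N)} (hω : ω ∈ returnSet c e r n) (hω' : ω' ∈ returnSet c e r n)
    (hu : ∀ i < n, ω.1 i = ω'.1 i) (hv : ∀ i < n, ω.2 i = ω'.2 i)
    (h1 : Real.ofDigits (fun i => e (ω.1 (i + n)) (ω.2 (i + n))) = 1 ↔
      Real.ofDigits (fun i => e (ω'.1 (i + n)) (ω'.2 (i + n))) = 1) :
    |(point c e ω).2 - (point c e ω').2| ≤ 4 * r / (m₂ : ℝ) ^ n :=
  abs_ofDigits_sub_le_of_return hm₂ hn (fun i hi => congrArg₂ e (hu i hi) (hv i hi)) h1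
    hω.2 hω'.2

theorem four_mul_exp_div_pow {m : ℕ} (hm : 0 < m) (l : ℝ) (n : ℕ) :
    4 * (2 * Real.exp (-l * n)) / (m : ℝ) ^ n = 8 * Real.exp (-(Real.log m + l) * n) := by
  rw [pow_eq_exp hm, mul_div_assoc, mul_div_assoc, ← Real.exp_sub, ← mul_assoc]
  norm_num
  ring

variable (c e)

/-- Covering by squares of the larger side length of the rectangles around periodic points. -/
theorem dimH_return_le_of_large_squares (hm₁ : 2 ≤ m₁) (hm : m₁ ≤ m₂) (hM : 0 < M) (hN : 0 < N)
    {l : ℝ} (hl : 0 ≤ l) :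
    dimH {x | ∃ᶠ n : ℕ in atTop, x ∈ point c e '' returnSet c e (2 * Real.exp (-l * n)) n} ≤
      ENNReal.ofReal ((Real.log M + Real.log N) / (Real.log m₁ + l)) := by
  classical
  have hα : 0 < Real.log m₁ := Real.log_pos (by exact_mod_cast hm₁)
  have hαβ : Real.log m₁ ≤ Real.log m₂ :=
    Real.log_le_log (by exact_mod_cast (by omega : 0 < m₁)) (by exact_mod_cast hm)
  have hLM : 0 ≤ Real.log M := Real.log_natCast_nonneg _
  have hLN : 0 ≤ Real.log N := Real.log_natCast_nonneg _
  refine dimH_limsup_le _ _ (C := 8) (by norm_num) (by linarith) (by linarith) fun n hn => ?_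
  refine ⟨(Fin n → Fin M) × (Fin n → Fin N) × Bool × Bool, inferInstance,
    fun ω => (fun i => ω.1 i, fun i => ω.2 i,
      decide (Real.ofDigits (fun i => c (ω.1 (i + n))) = 1),
      decide (Real.ofDigits (fun i => e (ω.1 (i + n)) (ω.2 (i + n))) = 1)), ?_, ?_⟩
  · simp only [Fintype.card_prod, Fintype.card_pi, Fintype.card_fin, Fintype.card_bool,
      Finset.prod_const, Finset.card_univ]
    push_cast
    rw [pow_eq_exp hM, pow_eq_exp hN, add_mul, Real.exp_add]
    have : 0 ≤ Real.exp (Real.log M * n) * Real.exp (Real.log N * n) := by positivity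
    nlinarith
  · intro ω hω ω' hω' h
    simp only [Prod.mk.injEq, decide_eq_decide] at h
    obtain ⟨hu, hv, h1, h2⟩ := h
    have hu : ∀ i < n, ω.1 i = ω'.1 i := fun i hi => congrFun hu ⟨i, hi⟩
    have hv : ∀ i < n, ω.2 i = ω'.2 i := fun i hi => congrFun hv ⟨i, hi⟩
    rw [Prod.dist_eq]
    refine max_le ?_ ?_
    · rw [← four_mul_exp_div_pow (by omega)]
      exact abs_point_fst_sub_le hm₁ hn hω hω' hu h1
    · refine (abs_point_snd_sub_le (by omega) hn hω hω' hu hv h2).trans ?_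
      rw [four_mul_exp_div_pow (by omega)]
      gcongr

/-- Covering by squares of the larger side length, several of the rectangles around periodic points
being covered at once. -/
theorem dimH_return_le_of_grouped_squares (hm₁ : 2 ≤ m₁) (hm : m₁ ≤ m₂) (hM : 0 < M) (hN : 0 < N)
    {l : ℝ} (hl : 0 ≤ l) (hlt : Real.log m₁ + l ≤ Real.log m₂) :
    dimH {x | ∃ᶠ n : ℕ in atTop, x ∈ point c e '' returnSet c e (2 * Real.exp (-l * n)) n} ≤
      ENNReal.ofReal ((Real.log M + Real.log N * ((Real.log m₁ + l) / Real.log m₂)) /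
        (Real.log m₁ + l)) := by
  classical
  have hα : 0 < Real.log m₁ := Real.log_pos (by exact_mod_cast hm₁)
  have hβ : 0 < Real.log m₂ := by linarith
  have hLM : 0 ≤ Real.log M := Real.log_natCast_nonneg _
  have hLN : 0 ≤ Real.log N := Real.log_natCast_nonneg _
  have hN1 : (1 : ℝ) ≤ N := by exact_mod_cast hN
  set α := Real.log m₁
  set β := Real.log m₂
  have hθ1 : (α + l) / β ≤ 1 := (div_le_one hβ).mpr hlt
  have hθ0 : 0 ≤ (α + l) / β := by positivity
  refine dimH_limsup_le _ _ (C := 8 * N) (by positivity) (by positivity) (by linarith)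
    fun n hn => ?_
  -- Here `k` is the number of second digits that brings the height down to the side e^{-(α+l)n}.
  -- Since `k ≤ n`, the recorded column letters suffice to decode these digits.
  have hk : ⌈n * ((α + l) / β)⌉₊ ≤ n := by
    refine Nat.ceil_le.mpr ?_
    nlinarith [(Nat.cast_nonneg n : (0 : ℝ) ≤ n)]
  have hk1 := Nat.le_ceil (n * ((α + l) / β))
  have hk2 := (Nat.ceil_lt_add_one (a := n * ((α + l) / β)) (by positivity)).le
  set k := ⌈n * ((α + l) / β)⌉₊
  refine ⟨(Fin n → Fin M) × (Fin k → Fin N) × Bool, inferInstance,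
    fun ω => (fun i => ω.1 i, fun i => ω.2 i,
      decide (Real.ofDigits (fun i => c (ω.1 (i + n))) = 1)), ?_, ?_⟩
  · simp only [Fintype.card_prod, Fintype.card_pi, Fintype.card_fin, Fintype.card_bool,
      Finset.prod_const, Finset.card_univ]
    push_cast
    rw [pow_eq_exp hM, pow_eq_exp hN, add_mul, Real.exp_add]
    have h3 : Real.exp (Real.log N * k) ≤ N * Real.exp (Real.log N * ((α + l) / β) * n) := by
      nth_rw 2 [← Real.exp_log (by linarith : (0 : ℝ) < N)]
      rw [← Real.exp_add]
      refine Real.exp_le_exp.mpr ?_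
      nlinarith
    have h4 := Real.exp_pos (Real.log M * n)
    have h5 := mul_le_mul_of_nonneg_left h3 h4.le
    have : 0 ≤ Real.exp (Real.log M * n) * (N * Real.exp (Real.log N * ((α + l) / β) * n)) := by
      positivity
    nlinarith
  · intro ω hω ω' hω' h
    simp only [Prod.mk.injEq, decide_eq_decide] at h
    obtain ⟨hu, hv, h1⟩ := h
    have hu : ∀ i < n, ω.1 i = ω'.1 i := fun i hi => congrFun hu ⟨i, hi⟩
    have hv : ∀ i < k, ω.2 i = ω'.2 i := fun i hi => congrFun hv ⟨i, hi⟩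
    have hexp := Real.exp_pos (-(α + l) * n)
    rw [Prod.dist_eq]
    refine max_le ?_ ?_
    · refine (abs_point_fst_sub_le hm₁ hn hω hω' hu h1).trans ?_
      rw [four_mul_exp_div_pow (by omega)]
      nlinarith
    · have hy : |(point c e ω).2 - (point c e ω').2| ≤ ((m₂ : ℝ) ^ k)⁻¹ :=
        Real.abs_ofDigits_sub_ofDigits_le fun i hi =>
          congrArg₂ e (hu i (hi.trans_le hk)) (hv i hi)
      refine hy.trans ?_
      rw [pow_eq_exp (by omega), ← Real.exp_neg]
      have : Real.exp (-(β * k)) ≤ Real.exp (-(α + l) * n) := by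
        refine Real.exp_le_exp.mpr ?_
        have : β * (n * ((α + l) / β)) = (α + l) * n := by field_simp
        nlinarith
      nlinarith

/-- Covering by squares of the smaller side length of the rectangles around periodic points. -/
theorem dimH_return_le_of_small_squares (hm₁ : 2 ≤ m₁) (hm : m₁ ≤ m₂) (hM : 0 < M) (hN : 0 < N)
    {l : ℝ} (hl : 0 ≤ l) :
    dimH {x | ∃ᶠ n : ℕ in atTop, x ∈ point c e '' returnSet c e (2 * Real.exp (-l * n)) n} ≤
      ENNReal.ofReal ((Real.log M * (Real.log m₂ / Real.log m₁) + Real.log N) /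
        (Real.log m₂ + l)) := by
  classical
  have hα : 0 < Real.log m₁ := Real.log_pos (by exact_mod_cast hm₁)
  have hαβ : Real.log m₁ ≤ Real.log m₂ :=
    Real.log_le_log (by exact_mod_cast (by omega : 0 < m₁)) (by exact_mod_cast hm)
  have hβ : 0 < Real.log m₂ := by linarith
  have hLM : 0 ≤ Real.log M := Real.log_natCast_nonneg _
  have hLN : 0 ≤ Real.log N := Real.log_natCast_nonneg _
  have hM1 : (1 : ℝ) ≤ M := by exact_mod_cast hM
  have hm₁r : (2 : ℝ) ≤ m₁ := by exact_mod_cast hm₁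
  have hmα : (m₁ : ℝ) = Real.exp (Real.log m₁) := (Real.exp_log (by linarith)).symm
  have hMα : (M : ℝ) = Real.exp (Real.log M) := (Real.exp_log (by linarith)).symm
  set α := Real.log m₁
  set β := Real.log m₂
  have hθ1 : 0 ≤ β / α - 1 := by rw [sub_nonneg, le_div_iff₀ hα]; linarith
  -- 40 = 2 · 2 · 10 counts the two flags and the residue mod 10; the factors M and m₁ pay for
  -- rounding `q` and `k`.
  refine dimH_limsup_le _ _ (C := 40 * M * m₁) (by positivity) (by positivity) (by linarith)
    fun n hn => ?_
  have hn0 : (0 : ℝ) ≤ n := Nat.cast_nonneg n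
  -- The width e^{-(α+l)n} fixes about `k` column digits; `q` more bring it down to the height, as
  -- m₁^{-(k+q)} is at most a constant times e^{-(β+l)n}.
  have hk1 := Nat.floor_le (a := n * (1 + l / α)) (by positivity)
  have hk2 := (Nat.lt_floor_add_one (n * (1 + l / α))).le
  set k := ⌊n * (1 + l / α)⌋₊
  have hq1 := Nat.le_ceil (n * (β / α - 1))
  have hq2 := (Nat.ceil_lt_add_one (a := n * (β / α - 1)) (by positivity)).le
  set q := ⌈n * (β / α - 1)⌉₊
  have eα : α * (n * (1 + l / α)) = (α + l) * n := by field_simp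
  have eβ : α * (n * (β / α - 1)) = (β - α) * n := by field_simp
  refine ⟨(Fin n → Fin M) × (Fin n → Fin N) × Bool × Bool × ZMod 10 × (Fin q → Fin M),
    inferInstance,
    fun ω => (fun i => ω.1 i, fun i => ω.2 i,
      decide (Real.ofDigits (fun i => c (ω.1 (i + n))) = 1),
      decide (Real.ofDigits (fun i => e (ω.1 (i + n)) (ω.2 (i + n))) = 1),
      (prefixValue (fun i => c (ω.1 i)) k : ZMod 10), fun i => ω.1 (i + k)), ?_, ?_⟩
  · simp only [Fintype.card_prod, Fintype.card_pi, Fintype.card_fin, Fintype.card_bool,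
      Finset.prod_const, Finset.card_univ, ZMod.card]
    push_cast
    rw [pow_eq_exp hM, pow_eq_exp hN, pow_eq_exp hM]
    calc _ = 40 * (Real.exp (Real.log M * n) * Real.exp (Real.log N * n) *
          Real.exp (Real.log M * q)) := by ring
      _ ≤ 40 * (M * Real.exp ((Real.log M * (β / α) + Real.log N) * n)) := by
          nth_rw 3 [hMα]
          rw [← Real.exp_add, ← Real.exp_add, ← Real.exp_add]
          refine mul_le_mul_of_nonneg_left (Real.exp_le_exp.mpr ?_) (by norm_num)
          nlinarith
      _ ≤ m₁ * (40 * (M * Real.exp ((Real.log M * (β / α) + Real.log N) * n))) :=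
          le_mul_of_one_le_left (by positivity) (by linarith)
      _ = _ := by ring
  · intro ω hω ω' hω' h
    simp only [Prod.mk.injEq, decide_eq_decide] at h
    obtain ⟨hu, hv, h1, h2, h3, h4⟩ := h
    have hu : ∀ i < n, ω.1 i = ω'.1 i := fun i hi => congrFun hu ⟨i, hi⟩
    have hv : ∀ i < n, ω.2 i = ω'.2 i := fun i hi => congrFun hv ⟨i, hi⟩
    have h4 : ∀ i < q, ω.1 (i + k) = ω'.1 (i + k) := fun i hi => congrFun h4 ⟨i, hi⟩
    have hexp := Real.exp_pos (-(β + l) * n)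
    have hx := abs_point_fst_sub_le hm₁ hn hω hω' hu h1
    rw [four_mul_exp_div_pow (by omega)] at hx
    have hxk : (m₁ : ℝ) ^ k * |(point c e ω).1 - (point c e ω').1| ≤ 8 := by
      rw [pow_eq_exp (by omega)]
      calc _ ≤ Real.exp (α * k) * (8 * Real.exp (-(α + l) * n)) := by gcongr
        _ = 8 * Real.exp (α * k + -(α + l) * n) := by rw [Real.exp_add]; ring
        _ ≤ 8 * Real.exp 0 := by
          gcongr
          nlinarith
        _ = 8 := by simp
    -- After scaling by m₁^k the points differ by at most 8 and the tails by at most 1, so the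
    -- integer prefixes differ by at most 9 and are separated by their residues mod 10.
    have hpre : prefixValue (fun i => c (ω.1 i)) k = prefixValue (fun i => c (ω'.1 i)) k := by
      have e1 := pow_mul_ofDigits (fun i => c (ω.1 i)) k
      have e2 := pow_mul_ofDigits (fun i => c (ω'.1 i)) k
      have b1 := Real.ofDigits_nonneg (fun i => c (ω.1 (i + k)))
      have b2 := Real.ofDigits_nonneg (fun i => c (ω'.1 (i + k)))
      have b3 := Real.ofDigits_le_one (fun i => c (ω.1 (i + k)))
      have b4 := Real.ofDigits_le_one (fun i => c (ω'.1 (i + k)))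
      have hxk' : |(m₁ : ℝ) ^ k * Real.ofDigits (fun i => c (ω.1 i)) -
          (m₁ : ℝ) ^ k * Real.ofDigits (fun i => c (ω'.1 i))| ≤ 8 := by
        rw [← mul_sub, abs_mul, abs_of_nonneg (by positivity)]
        exact hxk
      rw [e1, e2] at hxk'
      have hdvd := (ZMod.intCast_eq_intCast_iff_dvd_sub _ _ 10).mp h3
      have habs : |prefixValue (fun i => c (ω'.1 i)) k - prefixValue (fun i => c (ω.1 i)) k|
          < ((10 : ℕ) : ℤ) := by
        rw [abs_lt]
        rw [abs_le] at hxk'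
        constructor
        · have : (-10 : ℝ) < prefixValue (fun i => c (ω'.1 i)) k -
            prefixValue (fun i => c (ω.1 i)) k := by linarith
          exact_mod_cast this
        · have : (prefixValue (fun i => c (ω'.1 i)) k : ℝ) -
            prefixValue (fun i => c (ω.1 i)) k < 10 := by linarith
          exact_mod_cast this
      have := Int.eq_zero_of_abs_lt_dvd hdvd habs
      linarith
    rw [Prod.dist_eq]
    refine max_le ?_ ?_
    · refine (abs_ofDigits_sub_le_of_prefixValue_eq hpre
        fun i hi => congrArg c (h4 i hi)).trans ?_
      rw [pow_eq_exp (by omega), ← Real.exp_neg]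
      calc _ ≤ Real.exp (α + -(β + l) * n) := by
            refine Real.exp_le_exp.mpr ?_
            push_cast
            nlinarith
        _ = m₁ * Real.exp (-(β + l) * n) := by rw [Real.exp_add, ← hmα]
        _ ≤ (40 * M) * (m₁ * Real.exp (-(β + l) * n)) :=
            le_mul_of_one_le_left (by positivity) (by linarith)
        _ = _ := by ring
    · refine (abs_point_snd_sub_le (by omega) hn hω hω' hu hv h2).trans ?_
      rw [four_mul_exp_div_pow (by omega)]
      gcongr
      nlinarith

end Upper

/-! ### Copying blocks of a sequence -/

/-- Follow `src` as long as it decreases. -/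
def root (src : ℕ → ℕ) (j : ℕ) : ℕ :=
  if _h : src j < j then root src (src j) else j
termination_by j

open Classical in
/-- The position that `j` is a copy of, when each block `[nₖ, nₖ + aₖ)` copies `[0, aₖ)`. -/
noncomputable def copySource (n a : ℕ → ℕ) (j : ℕ) : ℕ :=
  if h : ∃ k, n k ≤ j ∧ j < n k + a k then j - n (Nat.find h) else j

theorem block_unique {n a : ℕ → ℕ} (h : ∀ k, n k + a k ≤ n (k + 1)) {j k k' : ℕ}
    (hk : n k ≤ j ∧ j < n k + a k) (hk' : n k' ≤ j ∧ j < n k' + a k') : k = k' := by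
  have hmono : Monotone n := monotone_nat_of_le_succ fun k => by have := h k; omega
  rcases lt_trichotomy k k' with hlt | rfl | hlt
  · have := hmono (Nat.succ_le_of_lt hlt)
    have := h k
    simp only [Nat.succ_eq_add_one] at *
    omega
  · rfl
  · have := hmono (Nat.succ_le_of_lt hlt)
    have := h k'
    simp only [Nat.succ_eq_add_one] at *
    omega

/-- The blocks are disjoint, so the first copying step from j + n_k leads to j. The source j may
itself lie in a block, even the same one; following sources down to a fixed point makes the copies
consistent. -/
theorem root_copySource_add {n a : ℕ → ℕ} (h : ∀ k, n k + a k ≤ n (k + 1)) (hn : ∀ k, 0 < n k)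
    {j k : ℕ} (hj : j < a k) : root (copySource n a) (j + n k) = root (copySource n a) j := by
  classical
  have hk : n k ≤ j + n k ∧ j + n k < n k + a k := by omega
  have hex : ∃ k', n k' ≤ j + n k ∧ j + n k < n k' + a k' := ⟨k, hk⟩
  have hfind : Nat.find hex = k := block_unique h (Nat.find_spec hex) hk
  have hsrc : copySource n a (j + n k) = j := by
    rw [copySource, dif_pos hex, hfind]
    omega
  have := hn k
  rw [root, dif_pos (by omega), hsrc]

theorem root_copySource_of_notMem {n a : ℕ → ℕ} {j : ℕ} (h : ¬ ∃ k, n k ≤ j ∧ j < n k + a k) :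
    root (copySource n a) j = j := by
  rw [root, dif_neg]
  rw [copySource, dif_neg h]
  exact lt_irrefl j

theorem card_root_ne_le {n a : ℕ → ℕ} (h : ∀ k, n k + a k ≤ n (k + 1)) {k L : ℕ}
    (hL : L ≤ n (k + 1)) :
    ((Finset.range L).filter fun j => root (copySource n a) j ≠ j).card ≤
      ∑ i ∈ Finset.range k, a i + min (a k) (L - n k) := by
  classical
  have hmono : Monotone n := monotone_nat_of_le_succ fun k => by have := h k; omega
  have hsub : ((Finset.range L).filter fun j => root (copySource n a) j ≠ j) ⊆
      ((Finset.range k).biUnion fun i => Finset.Ico (n i) (n i + a i)) ∪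
        Finset.Ico (n k) (min (n k + a k) L) := by
    intro j hj
    rw [Finset.mem_filter, Finset.mem_range] at hj
    have hex : ∃ i, n i ≤ j ∧ j < n i + a i := by
      by_contra hne
      exact hj.2 (root_copySource_of_notMem hne)
    obtain ⟨i, hi⟩ := hex
    rw [Finset.mem_union, Finset.mem_biUnion]
    rcases lt_trichotomy i k with hik | rfl | hik
    · exact Or.inl ⟨i, Finset.mem_range.mpr hik, Finset.mem_Ico.mpr hi⟩
    · exact Or.inr (Finset.mem_Ico.mpr ⟨hi.1, lt_min hi.2 hj.1⟩)
    · have := hmono (Nat.succ_le_of_lt hik)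
      simp only [Nat.succ_eq_add_one] at this
      omega
  refine (Finset.card_le_card hsub).trans ((Finset.card_union_le _ _).trans ?_)
  refine add_le_add (Finset.card_biUnion_le.trans (le_of_eq ?_)) ?_
  · simp
  · rw [Nat.card_Ico]
    omega

/-- The recursion carries the current term together with the total length of all earlier blocks; the
next element of `S` is taken large against both. -/
theorem exists_sparse_sequence {S : Set ℕ} (hS : S.Infinite) (B : ℕ → ℕ) {δ : ℝ} (hδ : 0 < δ) :
    ∃ n : ℕ → ℕ, (∀ k, n k ∈ S) ∧ (∀ k, 2 ≤ n k) ∧ (∀ k, n k + B (n k) ≤ n (k + 1)) ∧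
      ∀ k, ((∑ i ∈ Finset.range k, B (n i) : ℕ) : ℝ) ≤ δ * n k := by
  have hstep : ∀ p : ℕ × ℕ, ∃ n' ∈ S, 2 ≤ n' ∧ p.1 + B p.1 ≤ n' ∧
      ((p.2 + B p.1 : ℕ) : ℝ) ≤ δ * n' := by
    intro p
    obtain ⟨n', hn', hlt⟩ := hS.exists_gt
      (max 2 (max (p.1 + B p.1) ⌈((p.2 + B p.1 : ℕ) : ℝ) / δ⌉₊))
    simp only [max_lt_iff] at hlt
    refine ⟨n', hn', by omega, by omega, ?_⟩
    have := Nat.le_of_ceil_le hlt.2.2.le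
    rw [div_le_iff₀ hδ] at this
    linarith
  choose f hf using hstep
  let p : ℕ → ℕ × ℕ := fun k => Nat.rec (f (0, 0), 0) (fun _ q => (f q, q.2 + B q.1)) k
  have hp : ∀ k, p (k + 1) = (f (p k), (p k).2 + B (p k).1) := fun k => rfl
  have hsum : ∀ k, (p k).2 = ∑ i ∈ Finset.range k, B (p i).1 := by
    intro k
    induction k with
    | zero => rfl
    | succ k ih => rw [hp, Finset.sum_range_succ, ih]
  refine ⟨fun k => (p k).1, fun k => ?_, fun k => ?_, fun k => ?_, fun k => ?_⟩
  · cases k with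
    | zero => exact (hf (0, 0)).1
    | succ k => exact (hf (p k)).1
  · cases k with
    | zero => exact (hf (0, 0)).2.1
    | succ k => exact (hf (p k)).2.1
  · exact (hf (p k)).2.2.1
  · cases k with
    | zero => simp only [Finset.range_zero, Finset.sum_empty, Nat.cast_zero]; positivity
    | succ k =>
      rw [← hsum, hp]
      exact (hf (p k)).2.2.2

/-! ### A mass distribution principle -/

open MeasureTheory in
theorem le_dimH_of_measure_le {X : Type*} [MetricSpace X] [MeasurableSpace X] [BorelSpace X]
    (ν : Measure X) {E : Set X} (hE : ν E ≠ 0) {s C : ℝ} (hs : 0 < s) (hC : 0 < C)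
    (h : ∀ (U : Set X) (r : ℝ), 0 < r → r ≤ 1 → Metric.ediam U ≤ ENNReal.ofReal r →
      ν U ≤ ENNReal.ofReal (C * r ^ s)) :
    ENNReal.ofReal s ≤ dimH E := by
  have hpos : ∀ U : Set X, Metric.ediam U ≤ 1 → ν U ≤ ENNReal.ofReal C * Metric.ediam U ^ s := by
    intro U hU
    rcases eq_or_ne (Metric.ediam U) 0 with h0 | h0
    -- The hypothesis concerns positive radii only; diameter 0 is reached by letting r tend to 0.
    · rw [h0, ENNReal.zero_rpow_of_pos hs, mul_zero]
      have hlim : Tendsto (fun r : ℝ => ENNReal.ofReal (C * r ^ s)) (𝓝[>] 0) (𝓝 0) := by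
        have h1 : Tendsto (fun r : ℝ => C * r ^ s) (𝓝 0) (𝓝 (C * 0 ^ s)) :=
          ((Real.continuous_rpow_const hs.le).tendsto 0).const_mul C
        rw [Real.zero_rpow hs.ne', mul_zero] at h1
        simpa only [ENNReal.ofReal_zero] using
          ENNReal.tendsto_ofReal (h1.mono_left nhdsWithin_le_nhds)
      refine ge_of_tendsto hlim ?_
      filter_upwards [Ioc_mem_nhdsGT (zero_lt_one (α := ℝ))] with r hr
      exact h U r hr.1 hr.2 (by rw [h0]; exact zero_le)
    · have hfin : Metric.ediam U ≠ ⊤ := ne_top_of_le_ne_top ENNReal.one_ne_top hU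
      have hr : 0 < (Metric.ediam U).toReal := ENNReal.toReal_pos h0 hfin
      have := h U (Metric.ediam U).toReal hr
        (by simpa using ENNReal.toReal_mono ENNReal.one_ne_top hU) (by rw [ENNReal.ofReal_toReal hfin])
      rwa [ENNReal.ofReal_mul hC.le, ← ENNReal.ofReal_rpow_of_pos hr,
        ENNReal.ofReal_toReal hfin] at this
  have hC0 : ENNReal.ofReal C ≠ 0 := by simpa using hC
  have hle : (ENNReal.ofReal C)⁻¹ • ν ≤ Measure.hausdorffMeasure s := by
    refine Measure.le_hausdorffMeasure s _ 1 one_pos fun U hU => ?_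
    rw [Measure.smul_apply, smul_eq_mul, ← ENNReal.div_eq_inv_mul]
    exact ENNReal.div_le_of_le_mul' (hpos U hU)
  have hne : Measure.hausdorffMeasure (s.toNNReal : ℝ) E ≠ 0 := by
    rw [Real.coe_toNNReal s hs.le]
    intro h0
    have := hle E
    rw [h0, Measure.smul_apply, smul_eq_mul] at this
    rcases mul_eq_zero.mp (le_antisymm this zero_le) with h1 | h1
    · exact ENNReal.inv_ne_zero.mpr ENNReal.ofReal_ne_top h1
    · exact hE h1
  exact le_dimH_of_hausdorffMeasure_ne_zero hne

/-! ### An elementary inequality -/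

theorem linear_nonneg_of_endpoints {a b x y t : ℝ} (hx : 0 ≤ a + b * x) (hy : 0 ≤ a + b * y)
    (hxt : x ≤ t) (hty : t ≤ y) : 0 ≤ a + b * t := by
  rcases le_total 0 b with hb | hb <;> nlinarith

/-- In the application p = log M / α, q = log N / β, and w₁, w₂ are the lengths lost to the block at
n by scale e^{-t}. Between nα and n(β + l) the second summand is at least q · min(t, nβ), a minimum
of two linear functions, so nβ needs no condition of its own. It remains to check nα, where s ≤ p +
q is enough; n(α + l), where `h₂` and `h₃` are the two alternatives of the minimum; and n(β + l),
which is `h₁`. -/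
theorem mul_le_of_vertices {α β l p q s n t w₁ w₂ : ℝ} (hα : 0 < α) (hαβ : α ≤ β) (hl : 0 ≤ l)
    (hp : 0 ≤ p) (hq : 0 ≤ q) (hn : 0 ≤ n) (ht : 0 ≤ t)
    (h₁ : s * (β + l) ≤ (p + q) * β) (h₂ : s * (α + l) ≤ p * α + q * (α + l))
    (h₃ : s * (α + l) ≤ p * α + q * β)
    (hw₁ : w₁ ≤ n * l) (hw₁' : w₁ ≤ max 0 (t - n * α))
    (hw₂ : w₂ ≤ n * l) (hw₂' : w₂ ≤ max 0 (t - n * β)) :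
    s * t ≤ p * (t - w₁) + q * (t - w₂) := by
  have hβ : 0 < β := by linarith
  have hfull : s ≤ p + q := by
    by_contra hlt
    push Not at hlt
    nlinarith [mul_nonneg hp hl, mul_nonneg hq hl, mul_pos (sub_pos.mpr hlt) hβ]
  have hnl : 0 ≤ n * l := mul_nonneg hn hl
  have hpn : 0 ≤ p * n := mul_nonneg hp hn
  have hqn : 0 ≤ q * n := mul_nonneg hq hn
  have h₁n := mul_le_mul_of_nonneg_left h₁ hn
  have h₂n := mul_le_mul_of_nonneg_left h₂ hn
  have h₃n := mul_le_mul_of_nonneg_left h₃ hn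
  have hfn := mul_le_mul_of_nonneg_left hfull hn
  have hfnα := mul_le_mul_of_nonneg_left hfn hα.le
  have hnαβ : n * α ≤ n * β := by gcongr
  rcases le_total t (n * α) with ht1 | ht1
  · rw [max_eq_left (by linarith)] at hw₁' hw₂'
    nlinarith [mul_le_mul_of_nonneg_right hfull ht]
  rw [max_eq_right (by linarith)] at hw₁'
  rcases le_total (n * (β + l)) t with ht2 | ht2
  · have hβl : 0 < β + l := by linarith
    have e1 : p * (n * l) + q * (n * l) ≤ (p + q - s) * t := by
      have h5 : (p + q) * l ≤ (p + q - s) * (β + l) := by linarith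
      have h6 : (p + q - s) * (n * (β + l)) ≤ (p + q - s) * t :=
        mul_le_mul_of_nonneg_left ht2 (by linarith)
      have h7 := mul_le_mul_of_nonneg_left h5 hn
      linarith
    have e2 : p * w₁ ≤ p * (n * l) := mul_le_mul_of_nonneg_left hw₁ hp
    have e3 : q * w₂ ≤ q * (n * l) := mul_le_mul_of_nonneg_left hw₂ hq
    linarith
  -- between the two extreme regimes, the second summand is at least `q * min t (n * β)`
  have hq2 : q * t ≤ q * (t - w₂) ∨ q * (n * β) ≤ q * (t - w₂) := by
    rcases le_total 0 (t - n * β) with hh | hh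
    · rw [max_eq_right hh] at hw₂'
      exact Or.inr (mul_le_mul_of_nonneg_left (by linarith) hq)
    · rw [max_eq_left hh] at hw₂'
      exact Or.inl (mul_le_mul_of_nonneg_left (by linarith) hq)
  rcases le_total (n * (α + l)) t with ht3 | ht3
  · have e1 : p * (t - n * l) ≤ p * (t - w₁) := mul_le_mul_of_nonneg_left (by linarith) hp
    rcases hq2 with hq2 | hq2
    · have := linear_nonneg_of_endpoints (a := -(p * (n * l))) (b := p + q - s)
        (by linarith) (by nlinarith) ht3 ht2
      linarith
    · have := linear_nonneg_of_endpoints (a := -(p * (n * l)) + q * (n * β)) (b := p - s)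
        (by linarith) (by nlinarith) ht3 ht2
      linarith
  · have e1 : p * (n * α) ≤ p * (t - w₁) := mul_le_mul_of_nonneg_left (by linarith) hp
    rcases hq2 with hq2 | hq2
    · have := linear_nonneg_of_endpoints (a := p * (n * α)) (b := q - s)
        (by linarith) (by linarith) ht1 ht3
      linarith
    · have := linear_nonneg_of_endpoints (a := p * (n * α) + q * (n * β)) (b := -s)
        (by have := mul_le_mul_of_nonneg_left hnαβ hq; linarith) (by linarith) ht1 ht3
      linarith

open MeasureTheory

/-! ### The measure on a set of recurrent points -/

/-- The distribution of independent, uniformly distributed random digits. -/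
noncomputable def digitMeasure (M : ℕ) : Measure (ℕ → Fin M) :=
  Measure.infinitePi fun _ => ProbabilityTheory.uniformOn univ

instance (M : ℕ) [NeZero M] : IsProbabilityMeasure (digitMeasure M) := by
  have : IsProbabilityMeasure (ProbabilityTheory.uniformOn (univ : Set (Fin M))) :=
    ProbabilityTheory.isProbabilityMeasure_uniformOn finite_univ univ_nonempty
  unfold digitMeasure
  infer_instance

theorem digitMeasure_cylinder {M : ℕ} [NeZero M] (s : Finset ℕ) (f : ℕ → Fin M) :
    digitMeasure M {u | ∀ j ∈ s, u j = f j} =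
      ENNReal.ofReal (Real.exp (-(Real.log M * s.card))) := by
  have : IsProbabilityMeasure (ProbabilityTheory.uniformOn (univ : Set (Fin M))) :=
    ProbabilityTheory.isProbabilityMeasure_uniformOn finite_univ univ_nonempty
  have hset : {u : ℕ → Fin M | ∀ j ∈ s, u j = f j} = Set.pi s fun j => {f j} := by
    ext u; simp [Set.mem_pi]
  have hM : 0 < (M : ℝ) := by exact_mod_cast Nat.pos_of_ne_zero (NeZero.ne M)
  rw [hset, digitMeasure, Measure.infinitePi_pi _ (fun i _ => measurableSet_singleton _)]
  simp only [ProbabilityTheory.uniformOn_univ, Measure.count_singleton, Fintype.card_fin,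
    Finset.prod_const, one_div]
  rw [mul_comm, ← mul_neg, Real.exp_nat_mul, Real.exp_neg, Real.exp_log hM,
    ENNReal.ofReal_pow (by positivity), ENNReal.ofReal_inv_of_pos hM, ENNReal.ofReal_natCast]

variable {m₁ m₂ M N : ℕ} {c : Fin M → Fin m₁} {e : Fin M → Fin N → Fin m₂}

/-- The point whose digits at position `j` are those prescribed by `ω` at the positions `ρ₁ j`
and `ρ₂ j`. -/
noncomputable def copyPoint (c : Fin M → Fin m₁) (e : Fin M → Fin N → Fin m₂) (ρ₁ ρ₂ : ℕ → ℕ)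
    (ω : (ℕ → Fin M) × (ℕ → Fin N)) : ℝ × ℝ :=
  point c e (ω.1 ∘ ρ₁, ω.2 ∘ ρ₂)

theorem measurable_copyPoint (ρ₁ ρ₂ : ℕ → ℕ) : Measurable (copyPoint c e ρ₁ ρ₂) := by
  unfold copyPoint point coding
  refine Measurable.prodMk ?_ ?_
  · refine Real.continuous_ofDigits.measurable.comp (measurable_pi_lambda _ fun j => ?_)
    exact (Measurable.of_discrete (f := c)).comp ((measurable_pi_apply (ρ₁ j)).comp measurable_fst)
  · refine Real.continuous_ofDigits.measurable.comp (measurable_pi_lambda _ fun j => ?_)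
    have h : Measurable fun ω : (ℕ → Fin M) × (ℕ → Fin N) => (ω.1 (ρ₁ j), ω.2 (ρ₂ j)) :=
      ((measurable_pi_apply (ρ₁ j)).comp measurable_fst).prodMk
        ((measurable_pi_apply (ρ₂ j)).comp measurable_snd)
    exact (Measurable.of_discrete (f := fun p : Fin M × Fin N => e p.1 p.2)).comp h

/-- The number of fixed points of `ρ` below `k`. -/
def freeCount (ρ : ℕ → ℕ) (k : ℕ) : ℕ := ((Finset.range k).filter fun j => ρ j = j).card

theorem prefixValue_mem_Icc {b : ℕ} {d : ℕ → Fin b} {k : ℕ} {x₀ : ℝ}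
    (h : |Real.ofDigits d - x₀| ≤ ((b : ℝ) ^ k)⁻¹) :
    prefixValue d k ∈ Finset.Icc (⌊(b : ℝ) ^ k * x₀⌋ - 2) (⌊(b : ℝ) ^ k * x₀⌋ + 1) := by
  have hb : 0 < (b : ℝ) ^ k := by
    have : 0 < b := (d 0).pos
    positivity
  have hx : |(b : ℝ) ^ k * Real.ofDigits d - (b : ℝ) ^ k * x₀| ≤ 1 := by
    rw [← mul_sub, abs_mul, abs_of_pos hb]
    calc _ ≤ (b : ℝ) ^ k * ((b : ℝ) ^ k)⁻¹ := by gcongr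
      _ = 1 := mul_inv_cancel₀ hb.ne'
  rw [pow_mul_ofDigits, abs_le] at hx
  have h1 := Real.ofDigits_nonneg fun i => d (i + k)
  have h2 := Real.ofDigits_le_one fun i => d (i + k)
  have h3 := Int.floor_le ((b : ℝ) ^ k * x₀)
  have h4 := Int.lt_floor_add_one ((b : ℝ) ^ k * x₀)
  rw [Finset.mem_Icc]
  constructor
  · have : ((⌊(b : ℝ) ^ k * x₀⌋ - 2 : ℤ) : ℝ) ≤ prefixValue d k := by push_cast; linarith
    exact_mod_cast this
  · have : (prefixValue d k : ℝ) < ((⌊(b : ℝ) ^ k * x₀⌋ + 1 + 1 : ℤ) : ℝ) := by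
      push_cast; linarith
    exact Int.lt_add_one_iff.mp (by exact_mod_cast this)

/-- The first k column digits determine the column letters; as l ≤ k, the second digits can then be
decoded inside known columns. Only the fixed points of ρ₁ and ρ₂ are kept as constraints, and these
involve distinct independent letters. -/
theorem measure_prefix_le [NeZero M] [NeZero N] (hc : Function.Injective c)
    (he : ∀ i, Function.Injective (e i)) (ρ₁ ρ₂ : ℕ → ℕ) {k l : ℕ} (hlk : l ≤ k) (p q : ℤ) :
    (digitMeasure M).prod (digitMeasure N)
      {ω | prefixValue (fun j => c (ω.1 (ρ₁ j))) k = p ∧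
        prefixValue (fun j => e (ω.1 (ρ₁ j)) (ω.2 (ρ₂ j))) l = q} ≤
      ENNReal.ofReal (Real.exp
        (-(Real.log M * freeCount ρ₁ k + Real.log N * freeCount ρ₂ l))) := by
  rcases eq_empty_or_nonempty {ω : (ℕ → Fin M) × (ℕ → Fin N) |
      prefixValue (fun j => c (ω.1 (ρ₁ j))) k = p ∧
        prefixValue (fun j => e (ω.1 (ρ₁ j)) (ω.2 (ρ₂ j))) l = q} with h0 | ⟨ω₀, h1, h2⟩
  · rw [h0, measure_empty]; exact zero_le
  · have hsub : {ω : (ℕ → Fin M) × (ℕ → Fin N) |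
        prefixValue (fun j => c (ω.1 (ρ₁ j))) k = p ∧
          prefixValue (fun j => e (ω.1 (ρ₁ j)) (ω.2 (ρ₂ j))) l = q} ⊆
        {u | ∀ j ∈ (Finset.range k).filter fun j => ρ₁ j = j, u j = ω₀.1 j} ×ˢ
          {v | ∀ j ∈ (Finset.range l).filter fun j => ρ₂ j = j, v j = ω₀.2 j} := by
      rintro ω ⟨hω1, hω2⟩
      have hu : ∀ j < k, ω.1 (ρ₁ j) = ω₀.1 (ρ₁ j) := fun j hj =>
        hc (eq_of_prefixValue_eq (hω1.trans h1.symm) j hj)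
      have hv : ∀ j < l, ω.2 (ρ₂ j) = ω₀.2 (ρ₂ j) := fun j hj => by
        have h3 := eq_of_prefixValue_eq (hω2.trans h2.symm) j hj
        simp only [hu j (hj.trans_le hlk)] at h3
        exact he _ h3
      refine ⟨fun j hj => ?_, fun j hj => ?_⟩ <;>
        rw [Finset.mem_filter, Finset.mem_range] at hj
      · simpa only [hj.2] using hu j hj.1
      · simpa only [hj.2] using hv j hj.1
    refine (measure_mono hsub).trans (le_of_eq ?_)
    rw [Measure.prod_prod, digitMeasure_cylinder, digitMeasure_cylinder,
      ← ENNReal.ofReal_mul (Real.exp_pos _).le, ← Real.exp_add, neg_add]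
    rfl

/-- At most four integer prefixes are possible in each coordinate, hence the factor 16. -/
theorem measure_rectangle_le [NeZero M] [NeZero N] (hc : Function.Injective c)
    (he : ∀ i, Function.Injective (e i)) (ρ₁ ρ₂ : ℕ → ℕ) {k l : ℕ} (hlk : l ≤ k) (x₀ : ℝ × ℝ) :
    (digitMeasure M).prod (digitMeasure N)
      {ω | |(copyPoint c e ρ₁ ρ₂ ω).1 - x₀.1| ≤ ((m₁ : ℝ) ^ k)⁻¹ ∧
        |(copyPoint c e ρ₁ ρ₂ ω).2 - x₀.2| ≤ ((m₂ : ℝ) ^ l)⁻¹} ≤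
      ENNReal.ofReal (16 * Real.exp
        (-(Real.log M * freeCount ρ₁ k + Real.log N * freeCount ρ₂ l))) := by
  let I := Finset.Icc (⌊(m₁ : ℝ) ^ k * x₀.1⌋ - 2) (⌊(m₁ : ℝ) ^ k * x₀.1⌋ + 1) ×ˢ
    Finset.Icc (⌊(m₂ : ℝ) ^ l * x₀.2⌋ - 2) (⌊(m₂ : ℝ) ^ l * x₀.2⌋ + 1)
  have hI : I.card = 16 := by
    rw [Finset.card_product, Int.card_Icc, Int.card_Icc]
    have : ∀ z : ℤ, (z + 1 + 1 - (z - 2)).toNat = 4 := fun z => by omega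
    rw [this, this]
  have hsub : {ω | |(copyPoint c e ρ₁ ρ₂ ω).1 - x₀.1| ≤ ((m₁ : ℝ) ^ k)⁻¹ ∧
        |(copyPoint c e ρ₁ ρ₂ ω).2 - x₀.2| ≤ ((m₂ : ℝ) ^ l)⁻¹} ⊆
      ⋃ z ∈ I, {ω | prefixValue (fun j => c (ω.1 (ρ₁ j))) k = z.1 ∧
        prefixValue (fun j => e (ω.1 (ρ₁ j)) (ω.2 (ρ₂ j))) l = z.2} := by
    rintro ω ⟨h1, h2⟩
    refine mem_iUnion₂.mpr ⟨(_, _), Finset.mem_product.mpr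
      ⟨prefixValue_mem_Icc h1, prefixValue_mem_Icc h2⟩, rfl, rfl⟩
  refine (measure_mono hsub).trans ((measure_biUnion_finset_le _ _).trans ?_)
  refine (Finset.sum_le_sum fun z _ => measure_prefix_le hc he ρ₁ ρ₂ hlk z.1 z.2).trans ?_
  rw [Finset.sum_const, hI, nsmul_eq_mul, ENNReal.ofReal_mul (by norm_num)]
  norm_num

/-- The mass distribution principle for the images of independent digits. -/
theorem le_dimH_of_freeCount [NeZero M] [NeZero N] (hm₁ : 2 ≤ m₁) (hm : m₁ ≤ m₂)
    (hc : Function.Injective c) (he : ∀ i, Function.Injective (e i)) (ρ₁ ρ₂ : ℕ → ℕ)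
    {E : Set (ℝ × ℝ)} {s C : ℝ} (hs : 0 < s)
    (hcount : ∀ t : ℝ, 0 ≤ t → s * t - C ≤ Real.log M * freeCount ρ₁ ⌊t / Real.log m₁⌋₊ +
      Real.log N * freeCount ρ₂ ⌊t / Real.log m₂⌋₊)
    (s₁ s₂ : Finset ℕ) (f₁ : ℕ → Fin M) (f₂ : ℕ → Fin N)
    (hE : ∀ ω : (ℕ → Fin M) × (ℕ → Fin N), (∀ j ∈ s₁, ω.1 j = f₁ j) → (∀ j ∈ s₂, ω.2 j = f₂ j) →
      copyPoint c e ρ₁ ρ₂ ω ∈ E) :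
    ENNReal.ofReal s ≤ dimH E := by
  have hα : 0 < Real.log m₁ := Real.log_pos (by exact_mod_cast hm₁)
  have hαβ : Real.log m₁ ≤ Real.log m₂ :=
    Real.log_le_log (by exact_mod_cast (by omega : 0 < m₁)) (by exact_mod_cast hm)
  have hβ : 0 < Real.log m₂ := by linarith
  refine le_dimH_of_measure_le
    (((digitMeasure M).prod (digitMeasure N)).map (copyPoint c e ρ₁ ρ₂)) ?_ hs
    (C := 16 * Real.exp C) (by positivity) ?_
  · refine ne_of_gt (lt_of_lt_of_le ?_ (Measure.le_map_apply
      (measurable_copyPoint ρ₁ ρ₂).aemeasurable E))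
    have hsub : {u : ℕ → Fin M | ∀ j ∈ s₁, u j = f₁ j} ×ˢ {v : ℕ → Fin N | ∀ j ∈ s₂, v j = f₂ j} ⊆
        copyPoint c e ρ₁ ρ₂ ⁻¹' E := fun ω hω => hE ω hω.1 hω.2
    refine lt_of_lt_of_le ?_ (measure_mono hsub)
    rw [Measure.prod_prod, digitMeasure_cylinder, digitMeasure_cylinder,
      ← ENNReal.ofReal_mul (Real.exp_pos _).le]
    exact ENNReal.ofReal_pos.mpr (by positivity)
  · intro U r hr hr1 hU
    rcases eq_empty_or_nonempty U with rfl | ⟨x₀, hx₀⟩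
    · simp
    set t := -Real.log r with ht
    have ht0 : 0 ≤ t := by have := Real.log_nonpos hr.le hr1; linarith
    have hrt : r = Real.exp (-t) := by rw [ht, neg_neg, Real.exp_log hr]
    have hpow : ∀ {m : ℕ}, 0 < m → 0 < Real.log m →
        r ≤ ((m : ℝ) ^ ⌊t / Real.log m⌋₊)⁻¹ := by
      intro m hm0 hlog
      rw [pow_eq_exp hm0, ← Real.exp_neg, hrt]
      refine Real.exp_le_exp.mpr ?_
      have := Nat.floor_le (a := t / Real.log m) (by positivity)
      rw [le_div_iff₀ hlog] at this
      linarith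
    have hlk : ⌊t / Real.log m₂⌋₊ ≤ ⌊t / Real.log m₁⌋₊ := by gcongr
    have hball : U ⊆ Metric.closedBall x₀ r := by
      intro x hx
      have := (Metric.edist_le_ediam_of_mem hx hx₀).trans hU
      rw [edist_dist] at this
      exact (ENNReal.ofReal_le_ofReal_iff hr.le).mp this
    refine (measure_mono hball).trans ?_
    rw [Measure.map_apply (measurable_copyPoint ρ₁ ρ₂) Metric.isClosed_closedBall.measurableSet]
    refine (measure_mono ?_).trans ((measure_rectangle_le hc he ρ₁ ρ₂ hlk x₀).trans ?_)
    · intro ω hω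
      have hω := Metric.mem_closedBall.mp hω
      rw [Prod.dist_eq, max_le_iff] at hω
      exact ⟨hω.1.trans (hpow (by omega) hα), hω.2.trans (hpow (by omega) hβ)⟩
    · refine ENNReal.ofReal_le_ofReal ?_
      rw [mul_assoc]
      refine mul_le_mul_of_nonneg_left ?_ (by norm_num)
      rw [hrt, ← Real.exp_mul, ← Real.exp_add]
      refine Real.exp_le_exp.mpr ?_
      have := hcount t ht0
      linarith

/-! ### Return distance of a sequence that repeats its beginning -/

theorem ofDigits_lt_one {b : ℕ} {d : ℕ → Fin b} {i : ℕ} (h : (d i : ℕ) ≠ b - 1) :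
    Real.ofDigits d < 1 := by
  have hb : 0 < (b : ℝ) := by exact_mod_cast (d 0).pos
  have key := mul_ofDigits d
  have hle := Real.ofDigits_le_one fun i => d (i + 1)
  refine lt_of_mul_lt_mul_left (a := (b : ℝ)) ?_ hb.le
  rw [mul_one, key]
  induction i generalizing d with
  | zero =>
    have h1 : ((d 0 : ℕ) : ℝ) + 2 ≤ b := by
      have := (d 0).2
      exact_mod_cast (by omega : (d 0 : ℕ) + 2 ≤ b)
    linarith
  | succ i ih =>
    have h1 : Real.ofDigits (fun i => d (i + 1)) < 1 := by
      refine lt_of_mul_lt_mul_left (a := (b : ℝ)) ?_ hb.le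
      rw [mul_one, mul_ofDigits]
      exact ih (d := fun i => d (i + 1)) h (mul_ofDigits _) (Real.ofDigits_le_one _)
    have h2 : ((d 0 : ℕ) : ℝ) + 1 ≤ b := by exact_mod_cast (d 0).2
    linarith

theorem abs_sub_iterate_le {b : ℕ} {d : ℕ → Fin b} {n a i : ℕ} (hn : 1 ≤ n)
    (hlast : (d (i + n) : ℕ) ≠ b - 1) (hcopy : ∀ j < a, d (j + n) = d j) :
    |Real.ofDigits d - (timesMod b)^[n] (Real.ofDigits d)| ≤ ((b : ℝ) ^ a)⁻¹ := by
  classical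
  rw [iterate_timesMod_ofDigits d hn, if_neg, sub_zero]
  · exact Real.abs_ofDigits_sub_ofDigits_le fun j hj => (hcopy j hj).symm
  · exact (ofDigits_lt_one (d := fun j => d (j + n)) hlast).ne

/-! ### Lower bound -/

theorem freeCount_add_card_ne (ρ : ℕ → ℕ) (k : ℕ) :
    freeCount ρ k + ((Finset.range k).filter fun j => ρ j ≠ j).card = k := by
  rw [freeCount, Finset.card_filter_add_card_filter_not, Finset.card_range]

theorem exists_le_succ_and_le {n : ℕ → ℕ} (h : StrictMono n) (K : ℕ) :
    ∃ k, K ≤ n (k + 1) ∧ (k = 0 ∨ n k ≤ K) := by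
  have hex : ∃ k, K ≤ n k := ⟨K, h.le_apply⟩
  rcases hk : Nat.find hex with _ | k
  · have := Nat.find_spec hex
    rw [hk] at this
    exact ⟨0, this.trans (h.monotone (Nat.zero_le _)), Or.inl rfl⟩
  · have h1 := Nat.find_spec hex
    have h2 := Nat.find_min hex (m := k) (by omega)
    rw [hk] at h1
    exact ⟨k, h1, Or.inr (by omega)⟩

/-- The density of free positions, for blocks of length about `x * nₖ`. -/
theorem le_freeCount {n a : ℕ → ℕ} {x y δ γ : ℝ} {k : ℕ}
    (h : ∀ k, n k + a k ≤ n (k + 1)) (hγ : 0 < γ) (hy : ⌊y / γ⌋₊ ≤ n (k + 1))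
    (hx : (a k : ℝ) ≤ x / γ + 3) (hy0 : 0 ≤ y)
    (hsum : ((∑ i ∈ Finset.range k, a i : ℕ) : ℝ) ≤ δ) :
    ∃ w : ℝ, w ≤ x ∧ w ≤ max 0 (y - n k * γ) ∧
      (y - w) / γ - 4 - δ ≤ freeCount (root (copySource n a)) ⌊y / γ⌋₊ := by
  have hfloor := Nat.floor_le (a := y / γ) (by positivity)
  have hfloor' := Nat.lt_floor_add_one (y / γ)
  set K := ⌊y / γ⌋₊
  have h1 := card_root_ne_le h hy
  have h2 := freeCount_add_card_ne (root (copySource n a)) K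
  set w := min (a k) (K - n k)
  have hw1 : (w : ℝ) ≤ a k := by exact_mod_cast min_le_left _ _
  have h3 : (K : ℝ) ≤ freeCount (root (copySource n a)) K +
      (((∑ i ∈ Finset.range k, a i : ℕ) : ℝ) + w) := by
    exact_mod_cast (by omega : K ≤ freeCount (root (copySource n a)) K +
      (∑ i ∈ Finset.range k, a i + w))
  -- The 3 absorbs the rounding in the block length, and one more unit is lost to the floor of y /
  -- γ, whence the 4.
  refine ⟨γ * (w - 3), ?_, ?_, ?_⟩
  · have : (w : ℝ) - 3 ≤ x / γ := by linarith
    rw [le_div_iff₀ hγ] at this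
    linarith
  · have hw2 : (w : ℝ) ≤ ((K - n k : ℕ) : ℝ) := by exact_mod_cast min_le_right _ _
    rcases le_total K (n k) with hK | hK
    · rw [Nat.sub_eq_zero_of_le hK] at hw2
      refine le_max_of_le_left ?_
      push_cast at hw2
      nlinarith
    · rw [Nat.cast_sub hK] at hw2
      refine le_max_of_le_right ?_
      have : (w : ℝ) - 3 + n k ≤ y / γ := by linarith
      rw [le_div_iff₀ hγ] at this
      linarith
  · have : (y - γ * (w - 3)) / γ = y / γ - w + 3 := by field_simp; ring
    rw [this]
    linarith

theorem inv_pow_lt_exp {m : ℕ} (hm : 2 ≤ m) {l : ℝ} {n : ℕ} :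
    ((m : ℝ) ^ (⌈n * l / Real.log m⌉₊ + 2))⁻¹ < Real.exp (-l * n) := by
  have hlog : 0 < Real.log m := Real.log_pos (by exact_mod_cast hm)
  rw [pow_eq_exp (by omega), ← Real.exp_neg]
  refine Real.exp_lt_exp.mpr ?_
  have := Nat.le_ceil (n * l / Real.log m)
  rw [div_le_iff₀ hlog] at this
  push_cast
  linarith

section Lower

variable {m₁ m₂ M N : ℕ} {c : Fin M → Fin m₁} {e : Fin M → Fin N → Fin m₂}
  {A : Finset (Fin m₁ × Fin m₂)} {ψ : ℕ → ℝ}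

/-- Copying blocks of about nl/α and nl/β digits brings both coordinates back within e^{-ln}. The
extra 2 makes this strict and puts positions 0 and 1 into every copied block; since n_k ≥ 2 they are
free, and their prescribed letters keep both tails below 1. A second digit is repeated only where u
and v both are, which holds because b_k ≤ a_k. -/
theorem copyPoint_mem_recurrentSet (hm₁ : 2 ≤ m₁) (hm : m₁ ≤ m₂)
    (h : ∀ a, a ∈ A ↔ ∃ i j, (c i, e i j) = a) {l : ℝ} (hl : 0 ≤ l) {n a b : ℕ → ℕ}
    (hn : ∀ k, 2 ≤ n k) (hψ : ∀ k, Real.exp (-l * n k) ≤ ψ (n k))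
    (ha : ∀ k, a k = ⌈n k * l / Real.log m₁⌉₊ + 2) (hb : ∀ k, b k = ⌈n k * l / Real.log m₂⌉₊ + 2)
    (hsparse : ∀ k, n k + a k ≤ n (k + 1)) {ω : (ℕ → Fin M) × (ℕ → Fin N)}
    (h0 : (c (ω.1 0) : ℕ) ≠ m₁ - 1) (h1 : (e (ω.1 1) (ω.2 1) : ℕ) ≠ m₂ - 1) :
    copyPoint c e (root (copySource n a)) (root (copySource n b)) ω ∈ recurrentSet A ψ := by
  have hα : 0 < Real.log m₁ := Real.log_pos (by exact_mod_cast hm₁)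
  have hαβ : Real.log m₁ ≤ Real.log m₂ :=
    Real.log_le_log (by exact_mod_cast (by omega : 0 < m₁)) (by exact_mod_cast hm)
  have hba : ∀ k, b k ≤ a k := fun k => by
    rw [ha, hb]
    gcongr
  have hsparse' : ∀ k, n k + b k ≤ n (k + 1) := fun k => by
    have := hba k
    have := hsparse k
    omega
  have hmono : StrictMono n := strictMono_nat_of_lt_succ fun k => by
    have := hsparse k
    have := ha k
    omega
  have hn0 : ∀ k, 0 < n k := fun k => by have := hn k; omega
  have hfix : ∀ (a : ℕ → ℕ) (j : ℕ), j < 2 → root (copySource n a) j = j := fun a j hj =>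
    root_copySource_of_notMem fun ⟨k, hk, _⟩ => by have := hn k; omega
  have hr₁ : ∀ k, ∀ j < a k, root (copySource n a) (j + n k) = root (copySource n a) j :=
    fun k j hj => root_copySource_add hsparse hn0 hj
  have hr₂ : ∀ k, ∀ j < b k, root (copySource n b) (j + n k) = root (copySource n b) j :=
    fun k j hj => root_copySource_add hsparse' hn0 hj
  refine ⟨by rw [carpet_eq_range h]; exact ⟨_, rfl⟩, frequently_atTop.mpr fun m => ?_⟩
  refine ⟨n m, hmono.le_apply, ?_, ?_⟩
  · refine (abs_sub_iterate_le (a := a m) (i := 0) (hn0 m) ?_ ?_).trans_lt ?_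
    · have : 0 < a m := by rw [ha]; omega
      simpa only [Function.comp_apply, hr₁ m 0 this, hfix a 0 (by omega)] using h0
    · intro j hj
      simp only [Function.comp_apply, hr₁ m j hj]
    · rw [ha]
      exact (inv_pow_lt_exp hm₁).trans_le (hψ m)
  · refine (abs_sub_iterate_le (a := b m) (i := 1) (hn0 m) ?_ ?_).trans_lt ?_
    · have hb1 : 1 < b m := by rw [hb]; omega
      simpa only [Function.comp_apply, hr₁ m 1 (hb1.trans_le (hba m)), hr₂ m 1 hb1,
        hfix a 1 (by omega), hfix b 1 (by omega)] using h1
    · intro j hj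
      simp only [Function.comp_apply, hr₁ m j (hj.trans_le (hba m)), hr₂ m j hj]
    · rw [hb]
      exact (inv_pow_lt_exp (by omega)).trans_le (hψ m)

theorem le_dimH_recurrentSet (hm₁ : 2 ≤ m₁) (hm : m₁ ≤ m₂) (hc : Function.Injective c)
    (he : ∀ i, Function.Injective (e i)) (h : ∀ a, a ∈ A ↔ ∃ i j, (c i, e i j) = a)
    (hcol : ∃ a ∈ A, (a.1 : ℕ) ≠ m₁ - 1) (hrow : ∃ a ∈ A, (a.2 : ℕ) ≠ m₂ - 1)
    {l : ℝ} (hl : 0 ≤ l) (hS : {n : ℕ | Real.exp (-l * n) ≤ ψ n}.Infinite) {s : ℝ}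
    (h₁ : s * (Real.log m₂ + l) ≤ Real.log M * (Real.log m₂ / Real.log m₁) + Real.log N)
    (h₂ : s * (Real.log m₁ + l) ≤
      Real.log M + Real.log N * ((Real.log m₁ + l) / Real.log m₂))
    (h₃ : s * (Real.log m₁ + l) ≤ Real.log M + Real.log N) :
    ENNReal.ofReal s ≤ dimH (recurrentSet A ψ) := by
  rcases le_or_gt s 0 with hs | hs
  · rw [ENNReal.ofReal_of_nonpos hs]; exact zero_le
  obtain ⟨a₀, ha₀, hlast₀⟩ := hcol
  obtain ⟨a₁, ha₁, hlast₁⟩ := hrow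
  obtain ⟨i₀, j₀, rfl⟩ := (h a₀).mp ha₀
  obtain ⟨i₁, j₁, rfl⟩ := (h a₁).mp ha₁
  have : NeZero M := ⟨fun h0 => by have := i₀.2; omega⟩
  have : NeZero N := ⟨fun h0 => by have := j₀.2; omega⟩
  have hα : 0 < Real.log m₁ := Real.log_pos (by exact_mod_cast hm₁)
  have hαβ : Real.log m₁ ≤ Real.log m₂ :=
    Real.log_le_log (by exact_mod_cast (by omega : 0 < m₁)) (by exact_mod_cast hm)
  have hβ : 0 < Real.log m₂ := by linarith
  have hLM : 0 ≤ Real.log M := Real.log_natCast_nonneg _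
  have hLN : 0 ≤ Real.log N := Real.log_natCast_nonneg _
  suffices H : ∀ ε : ℝ, 0 < ε → ε < s →
      ENNReal.ofReal (s - ε) ≤ dimH (recurrentSet A ψ) by
    have hlim : Tendsto (fun ε : ℝ => ENNReal.ofReal (s - ε)) (𝓝[>] 0) (𝓝 (ENNReal.ofReal s)) := by
      have : Tendsto (fun ε : ℝ => s - ε) (𝓝[>] 0) (𝓝 (s - 0)) :=
        (tendsto_const_nhds.sub tendsto_id).mono_left nhdsWithin_le_nhds
      rw [sub_zero] at this
      exact ENNReal.tendsto_ofReal this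
    refine le_of_tendsto hlim ?_
    filter_upwards [Ioo_mem_nhdsGT hs] with ε hε
    exact H ε hε.1 hε.2
  intro ε hε hεs
  set α := Real.log m₁
  set β := Real.log m₂
  set D := Real.log M + Real.log N + 1
  have hD : 0 < D := by positivity
  -- This δ makes the earlier blocks cost at most ε t in the exponent, because n_k ≤ t/α as soon as
  -- there are earlier blocks.
  obtain ⟨n, hnS, hn2, hsparse, hsum⟩ := exists_sparse_sequence hS
    (fun n => ⌈n * l / α⌉₊ + 2) (δ := ε * α / D) (by positivity)
  set a : ℕ → ℕ := fun k => ⌈n k * l / α⌉₊ + 2 with ha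
  set b : ℕ → ℕ := fun k => ⌈n k * l / β⌉₊ + 2 with hb
  have hba : ∀ k, b k ≤ a k := fun k => by
    simp only [ha, hb]
    gcongr
  have hmono : StrictMono n := strictMono_nat_of_lt_succ fun k => by
    have := hsparse k
    omega
  -- Position 0 carries a cell outside the last column and position 1 a cell outside the last row; a
  -- single cell need not avoid both. The constant `C` collects the rounding losses of 4 places per
  -- coordinate.
  refine le_dimH_of_freeCount (c := c) (e := e) hm₁ hm hc he (root (copySource n a))
    (root (copySource n b)) (C := 4 * (Real.log M + Real.log N)) (by linarith) ?_
    {0, 1} {1} (fun j => if j = 0 then i₀ else i₁) (fun _ => j₁) ?_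
  · intro t ht
    obtain ⟨k, hk1, hk2⟩ := exists_le_succ_and_le hmono ⌊t / α⌋₊
    have hceil : ∀ γ : ℝ, 0 < γ → ((⌈n k * l / γ⌉₊ + 2 : ℕ) : ℝ) ≤ n k * l / γ + 3 := by
      intro γ hγ
      have := (Nat.ceil_lt_add_one (a := n k * l / γ) (by positivity)).le
      push_cast
      linarith
    have hsum₁ : ((∑ i ∈ Finset.range k, a i : ℕ) : ℝ) ≤ ε * t / D := by
      rcases hk2 with rfl | hk2
      · simp only [Finset.range_zero, Finset.sum_empty, Nat.cast_zero]
        positivity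
      · refine (hsum k).trans ?_
        have h5 : (n k : ℝ) ≤ t / α :=
          le_trans (by exact_mod_cast hk2) (Nat.floor_le (by positivity))
        calc ε * α / D * n k ≤ ε * α / D * (t / α) := by gcongr
          _ = ε * t / D := by field_simp
    have hsum₂ : ((∑ i ∈ Finset.range k, b i : ℕ) : ℝ) ≤ ε * t / D :=
      le_trans (by exact_mod_cast Finset.sum_le_sum fun i _ => hba i) hsum₁
    obtain ⟨w₁, hw₁, hw₁', hf₁⟩ := le_freeCount (a := a) hsparse hα hk1 (hceil α hα) ht hsum₁
    obtain ⟨w₂, hw₂, hw₂', hf₂⟩ := le_freeCount (a := b)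
      (fun k => (Nat.add_le_add_left (hba k) _).trans (hsparse k)) hβ
      (le_trans (by gcongr) hk1) (hceil β hβ) ht hsum₂
    have hmain := mul_le_of_vertices (p := Real.log M / α) (q := Real.log N / β) (s := s) hα hαβ hl
      (by positivity) (by positivity) (Nat.cast_nonneg (n k)) ht
      (by rw [add_mul, div_mul_cancel₀ _ hβ.ne']; calc _ ≤ _ := h₁
            _ = _ := by ring)
      (by rw [div_mul_cancel₀ _ hα.ne']; calc _ ≤ _ := h₂
            _ = _ := by ring)
      (by rw [div_mul_cancel₀ _ hα.ne', div_mul_cancel₀ _ hβ.ne']; exact h₃)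
      hw₁ hw₁' hw₂ hw₂'
    have h6 := mul_le_mul_of_nonneg_left hf₁ hLM
    have h7 := mul_le_mul_of_nonneg_left hf₂ hLN
    have h8 : (Real.log M + Real.log N) * (ε * t / D) ≤ ε * t := by
      calc _ ≤ D * (ε * t / D) := by
            gcongr
            simp only [D]; linarith
        _ = ε * t := by field_simp
    have e1 : Real.log M / α * (t - w₁) = Real.log M * ((t - w₁) / α) := by ring
    have e2 : Real.log N / β * (t - w₂) = Real.log N * ((t - w₂) / β) := by ring
    linarith
  · intro ω hω₁ hω₂
    have e0 : ω.1 0 = i₀ := by simpa using hω₁ 0 (by simp)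
    have e1 : ω.1 1 = i₁ := by simpa using hω₁ 1 (by simp)
    have e2 : ω.2 1 = j₁ := hω₂ 1 (by simp)
    exact copyPoint_mem_recurrentSet hm₁ hm h hl hn2 hnS (fun _ => rfl) (fun _ => rfl) hsparse
      (by rw [e0]; exact hlast₀) (by rw [e1, e2]; exact hlast₁)

/-! ### The dimension in terms of the natural decay rate -/

theorem recurrentSet_subset (h : ∀ a, a ∈ A ↔ ∃ i j, (c i, e i j) = a) {l : ℝ}
    (hl : l = 0 ∨ ∀ᶠ n : ℕ in atTop, ψ n ≤ Real.exp (-l * n)) :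
    recurrentSet A ψ ⊆
      {x | ∃ᶠ n : ℕ in atTop, x ∈ point c e '' returnSet c e (2 * Real.exp (-l * n)) n} := by
  rintro x ⟨hx, hfreq⟩
  rw [carpet_eq_range h] at hx
  obtain ⟨ω, rfl⟩ := hx
  -- At rate 0 every point returns within 2, so nothing about ψ is needed; this covers l = 0, where
  -- ψ need not be bounded.
  rcases hl with rfl | hl
  · have hbound : ∀ {b : ℕ} (d : ℕ → Fin b) {n : ℕ}, 1 ≤ n →
        |Real.ofDigits d - (timesMod b)^[n] (Real.ofDigits d)| ≤ 2 := by
      intro b d n hn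
      rw [iterate_timesMod b _ hn, abs_le]
      have h1 := Real.ofDigits_nonneg d
      have h2 := Real.ofDigits_le_one d
      have h3 := Int.fract_nonneg ((b : ℝ) ^ n * Real.ofDigits d)
      have h4 := Int.fract_lt_one ((b : ℝ) ^ n * Real.ofDigits d)
      constructor <;> linarith
    refine Eventually.frequently ?_
    filter_upwards [eventually_ge_atTop 1] with n hn
    refine ⟨ω, ?_, rfl⟩
    simp only [neg_zero, zero_mul, Real.exp_zero, mul_one]
    exact ⟨hbound _ hn, hbound _ hn⟩
  · refine (hfreq.and_eventually hl).mono ?_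
    rintro n ⟨⟨h1, h2⟩, h3⟩
    have h4 := Real.exp_pos (-l * n)
    exact ⟨ω, ⟨by linarith, by linarith⟩, rfl⟩

/-- The decay hypothesis controls ψ only at rates strictly below l, and rate 0 is free; continuity
of the bound then reaches l itself. -/
theorem le_ofReal_of_continuousAt {d : ℝ≥0∞} {g : ℝ → ℝ} {l : ℝ} (hl : 0 ≤ l)
    (hg : ContinuousAt g l) (h : ∀ l', 0 ≤ l' → l' ≤ l → (l' = 0 ∨ l' < l) → d ≤ ENNReal.ofReal (g l')) :
    d ≤ ENNReal.ofReal (g l) := by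
  have h1 : Tendsto (fun ε : ℝ => max 0 (l - ε)) (𝓝[>] 0) (𝓝 l) := by
    have : Tendsto (fun ε : ℝ => max 0 (l - ε)) (𝓝 0) (𝓝 (max 0 (l - 0))) := by
      refine Continuous.tendsto ?_ 0
      fun_prop
    rw [sub_zero, max_eq_right hl] at this
    exact this.mono_left nhdsWithin_le_nhds
  refine ge_of_tendsto (ENNReal.tendsto_ofReal (hg.tendsto.comp h1)) ?_
  filter_upwards [self_mem_nhdsWithin] with ε hε
  have hε : 0 < ε := hε
  refine h _ (le_max_left _ _) (max_le hl (by linarith)) ?_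
  rcases le_total (l - ε) 0 with h2 | h2
  · exact Or.inl (max_eq_left h2)
  · exact Or.inr (by simp only [max_eq_right h2]; linarith)

theorem dimH_recurrentSet_eq (hm₁ : 2 ≤ m₁) (hm : m₁ ≤ m₂) (hc : Function.Injective c)
    (he : ∀ i, Function.Injective (e i)) (h : ∀ a, a ∈ A ↔ ∃ i j, (c i, e i j) = a)
    (hcol : ∃ a ∈ A, (a.1 : ℕ) ≠ m₁ - 1) (hrow : ∃ a ∈ A, (a.2 : ℕ) ≠ m₂ - 1)
    {l : ℝ} (hl : 0 ≤ l) (hlow : ∀ l' < l, ∀ᶠ n : ℕ in atTop, ψ n ≤ Real.exp (-l' * n))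
    (hup : ∀ l' > l, ∃ᶠ n : ℕ in atTop, Real.exp (-l' * n) ≤ ψ n) :
    dimH (recurrentSet A ψ) = ENNReal.ofReal (min
      ((Real.log M * (Real.log m₂ / Real.log m₁) + Real.log N) / (Real.log m₂ + l))
      (min ((Real.log M + Real.log N * ((Real.log m₁ + l) / Real.log m₂)) / (Real.log m₁ + l))
        ((Real.log M + Real.log N) / (Real.log m₁ + l)))) := by
  obtain ⟨a₀, ha₀, -⟩ := id hcol
  obtain ⟨i₀, j₀, -⟩ := (h a₀).mp ha₀
  have hM : 0 < M := i₀.pos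
  have hN : 0 < N := j₀.pos
  have hα : 0 < Real.log m₁ := Real.log_pos (by exact_mod_cast hm₁)
  have hαβ : Real.log m₁ ≤ Real.log m₂ :=
    Real.log_le_log (by exact_mod_cast (by omega : 0 < m₁)) (by exact_mod_cast hm)
  have hβ : 0 < Real.log m₂ := by linarith
  have hLN : 0 ≤ Real.log N := Real.log_natCast_nonneg _
  set α := Real.log m₁
  set β := Real.log m₂
  have hsub : ∀ l', l' ≤ l → (l' = 0 ∨ l' < l) → recurrentSet A ψ ⊆
      {x | ∃ᶠ n : ℕ in atTop, x ∈ point c e '' returnSet c e (2 * Real.exp (-l' * n)) n} :=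
    fun l' _ h2 => recurrentSet_subset h (h2.imp_right (hlow l'))
  have c₁ : ContinuousAt (fun x => (Real.log M * (β / α) + Real.log N) / (β + x)) l :=
    ContinuousAt.div (by fun_prop) (by fun_prop) (by positivity)
  have c₂ : ContinuousAt (fun x => (Real.log M + Real.log N * ((α + x) / β)) / (α + x)) l :=
    ContinuousAt.div (by fun_prop) (by fun_prop) (by positivity)
  have c₃ : ContinuousAt (fun x => (Real.log M + Real.log N) / (α + x)) l :=
    ContinuousAt.div (by fun_prop) (by fun_prop) (by positivity)
  apply le_antisymm
  · have u₁ : dimH (recurrentSet A ψ) ≤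
        ENNReal.ofReal ((Real.log M * (β / α) + Real.log N) / (β + l)) :=
      le_ofReal_of_continuousAt (l := l) hl c₁ fun l' h1 h2 h3 =>
        (dimH_mono (hsub l' h2 h3)).trans (dimH_return_le_of_small_squares c e hm₁ hm hM hN h1)
    have u₃ : dimH (recurrentSet A ψ) ≤
        ENNReal.ofReal ((Real.log M + Real.log N) / (α + l)) :=
      le_ofReal_of_continuousAt (l := l) hl c₃ fun l' h1 h2 h3 =>
        (dimH_mono (hsub l' h2 h3)).trans (dimH_return_le_of_large_squares c e hm₁ hm hM hN h1)
    have u₂ : dimH (recurrentSet A ψ) ≤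
        ENNReal.ofReal ((Real.log M + Real.log N * ((α + l) / β)) / (α + l)) := by
      rcases le_total (α + l) β with hcase | hcase
      · exact le_ofReal_of_continuousAt (l := l) hl c₂ fun l' h1 h2 h3 =>
          (dimH_mono (hsub l' h2 h3)).trans
            (dimH_return_le_of_grouped_squares c e hm₁ hm hM hN h1 (by linarith))
      -- For α + l ≥ β grouping gains nothing, and the second value is at least the third.
      · refine u₃.trans (ENNReal.ofReal_le_ofReal ?_)
        have : 1 ≤ (α + l) / β := (one_le_div hβ).mpr hcase
        gcongr
        nlinarith
    rw [ENNReal.ofReal_min, ENNReal.ofReal_min]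
    exact le_min u₁ (le_min u₂ u₃)
  -- For each l' > l infinitely many times satisfy ψ(n) ≥ e^{-l'n}; the lower bounds at l' pass to
  -- the limit as l' decreases to l.
  · have hcont := (c₁.tendsto.min (c₂.tendsto.min c₃.tendsto)).mono_left
      (nhdsWithin_le_nhds (s := Ioi l))
    refine le_of_tendsto (ENNReal.tendsto_ofReal hcont) ?_
    filter_upwards [self_mem_nhdsWithin] with l' hl'
    have hl' : l < l' := hl'
    have hl0 : 0 ≤ l' := by linarith
    have pα : 0 < α + l' := by positivity
    have pβ : 0 < β + l' := by positivity
    refine le_dimH_recurrentSet hm₁ hm hc he h hcol hrow hl0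
      (Nat.frequently_atTop_iff_infinite.mp (hup l' hl')) ?_ ?_ ?_
    · exact (le_div_iff₀ pβ).mp (min_le_left _ _)
    · exact (le_div_iff₀ pα).mp ((min_le_right _ _).trans (min_le_left _ _))
    · exact (le_div_iff₀ pα).mp ((min_le_right _ _).trans (min_le_right _ _))

/-- For superexponential decay the bound by large squares holds at every rate l ≥ 0 and tends to 0.
-/
theorem dimH_recurrentSet_eq_zero (hm₁ : 2 ≤ m₁) (hm : m₁ ≤ m₂)
    (h : ∀ a, a ∈ A ↔ ∃ i j, (c i, e i j) = a) (hA : A.Nonempty)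
    (hlow : ∀ l, ∀ᶠ n : ℕ in atTop, ψ n ≤ Real.exp (-l * n)) :
    dimH (recurrentSet A ψ) = 0 := by
  obtain ⟨a₀, ha₀⟩ := hA
  obtain ⟨i₀, j₀, -⟩ := (h a₀).mp ha₀
  have hlim : Tendsto (fun l : ℝ => ENNReal.ofReal ((Real.log M + Real.log N) /
      (Real.log m₁ + l))) atTop (𝓝 (ENNReal.ofReal 0)) :=
    ENNReal.tendsto_ofReal (tendsto_const_nhds.div_atTop
      (tendsto_atTop_add_const_left _ _ tendsto_id))
  rw [ENNReal.ofReal_zero] at hlim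
  refine le_antisymm (ge_of_tendsto hlim ?_) zero_le
  filter_upwards [eventually_ge_atTop 0] with l hl
  exact (dimH_mono (recurrentSet_subset h (Or.inr (hlow l)))).trans
    (dimH_return_le_of_large_squares c e hm₁ hm i₀.pos j₀.pos hl)

end Lower

/-! ### Decay rates -/

section Decay

variable {ψ : ℕ → ℝ} {m : ℕ}

theorem decayRate_eq_mul {m₁ m₂ : ℕ} (hm₁ : 2 ≤ m₁) (hm₂ : 2 ≤ m₂) :
    decayRate m₂ ψ = ((Real.log m₁ / Real.log m₂ : ℝ) : EReal) * decayRate m₁ ψ := by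
  have hα : 0 < Real.log m₁ := Real.log_pos (by exact_mod_cast hm₁)
  have hβ : 0 < Real.log m₂ := Real.log_pos (by exact_mod_cast hm₂)
  unfold decayRate
  rw [← EReal.liminf_const_mul_of_nonneg_of_ne_top (by exact_mod_cast (by positivity))
    (EReal.coe_ne_top _)]
  congr 1
  funext n
  rw [← EReal.coe_mul]
  congr 1
  simp only [Real.logb]
  field_simp

theorem eventually_le_exp_of_lt_decayRate (hm : 2 ≤ m) (hψ : ∀ n, 0 < ψ n) {l : ℝ}
    (h : ((l / Real.log m : ℝ) : EReal) < decayRate m ψ) :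
    ∀ᶠ n : ℕ in atTop, ψ n ≤ Real.exp (-l * n) := by
  have hlog : 0 < Real.log m := Real.log_pos (by exact_mod_cast hm)
  filter_upwards [eventually_lt_of_lt_liminf h, eventually_ge_atTop 1] with n hn hn1
  have hn0 : (0 : ℝ) < n := by exact_mod_cast hn1
  have hn' := EReal.coe_lt_coe_iff.mp hn
  rw [Real.logb, lt_div_iff₀ hn0, ← neg_div, div_mul_eq_mul_div,
    div_lt_div_iff_of_pos_right hlog] at hn'
  rw [← Real.log_le_iff_le_exp (hψ n)]
  linarith

theorem frequently_exp_le_of_decayRate_lt (hm : 2 ≤ m) (hψ : ∀ n, 0 < ψ n) {l : ℝ}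
    (h : decayRate m ψ < ((l / Real.log m : ℝ) : EReal)) :
    ∃ᶠ n : ℕ in atTop, Real.exp (-l * n) ≤ ψ n := by
  have hlog : 0 < Real.log m := Real.log_pos (by exact_mod_cast hm)
  refine ((frequently_lt_of_liminf_lt (by isBoundedDefault) h).and_eventually
    (eventually_ge_atTop 1)).mono ?_
  rintro n ⟨hn, hn1⟩
  have hn0 : (0 : ℝ) < n := by exact_mod_cast hn1
  have hn' := EReal.coe_lt_coe_iff.mp hn
  rw [Real.logb, div_lt_iff₀ hn0, ← neg_div, div_mul_eq_mul_div,
    div_lt_div_iff_of_pos_right hlog] at hn'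
  rw [← Real.le_log_iff_exp_le (hψ n)]
  linarith

end Decay

end BedfordMcMullen

/-! ### From the natural decay rate to the two cases -/

theorem theorem2p1 (m₁ m₂ : ℕ) (hm₁ : 2 ≤ m₁) (hm : m₁ ≤ m₂)
    (A : Finset (Fin m₁ × Fin m₂))
    -- `A` is nonempty, and neither contained in the last column nor in the last row
    (hcol : ∃ a ∈ A, (a.1 : ℕ) ≠ m₁ - 1) (hrow : ∃ a ∈ A, (a.2 : ℕ) ≠ m₂ - 1)
    (M N : ℕ) (hM : (BedfordMcMullen.columns A).card = M)
    (hN : ∀ i ∈ BedfordMcMullen.columns A, BedfordMcMullen.columnCount A i = N)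
    (ψ : ℕ → ℝ) (hψ : ∀ n, 0 < ψ n)
    (τ₁ τ₂ : EReal) (hτ₁ : τ₁ = BedfordMcMullen.decayRate m₁ ψ)
    (hτ₂ : τ₂ = BedfordMcMullen.decayRate m₂ ψ) (hτ : 0 ≤ τ₁) :
    (1 + τ₁ < (Real.logb m₁ m₂ : EReal) →
      ((dimH (BedfordMcMullen.recurrentSet A ψ) : ℝ≥0∞) : EReal) =
        min (((Real.logb m₁ M + Real.logb m₂ N : ℝ) : EReal) / (1 + τ₂))
          ((Real.logb m₁ M : EReal) / (1 + τ₁) + (Real.logb m₂ N : EReal))) ∧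
    ((Real.logb m₁ m₂ : EReal) ≤ 1 + τ₁ →
      ((dimH (BedfordMcMullen.recurrentSet A ψ) : ℝ≥0∞) : EReal) =
        min (((Real.logb m₁ M + Real.logb m₂ N : ℝ) : EReal) / (1 + τ₂))
          (((Real.logb m₁ M + Real.logb m₁ N : ℝ) : EReal) / (1 + τ₁))) := by
  obtain ⟨c, e, hc, he, h⟩ := BedfordMcMullen.exists_parametrization A hM hN
  have hα : 0 < Real.log m₁ := Real.log_pos (by exact_mod_cast hm₁)
  have hβ : 0 < Real.log m₂ := Real.log_pos (by exact_mod_cast (by omega : 1 < m₂))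
  have hLM : 0 ≤ Real.log M := Real.log_natCast_nonneg _
  have hLN : 0 ≤ Real.log N := Real.log_natCast_nonneg _
  have hτ₂₁ : τ₂ = ((Real.log m₁ / Real.log m₂ : ℝ) : EReal) * τ₁ := by
    rw [hτ₁, hτ₂, BedfordMcMullen.decayRate_eq_mul hm₁ (by omega)]
  induction τ₁ using EReal.rec with
  | bot => simp at hτ
  | top =>
    have hdim : dimH (BedfordMcMullen.recurrentSet A ψ) = 0 :=
      BedfordMcMullen.dimH_recurrentSet_eq_zero hm₁ hm h (hcol.imp fun _ ha => ha.1) fun l =>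
        BedfordMcMullen.eventually_le_exp_of_lt_decayRate hm₁ hψ
          (by rw [← hτ₁]; exact EReal.coe_lt_top _)
    have htop : (1 : EReal) + ⊤ = ⊤ := EReal.add_top_of_ne_bot (by decide)
    rw [EReal.coe_mul_top_of_pos (by positivity)] at hτ₂₁
    rw [hτ₂₁, hdim, htop]
    refine ⟨fun hlt => absurd hlt not_top_lt, fun _ => ?_⟩
    simp
  | coe t =>
    have ht : 0 ≤ t := by exact_mod_cast hτ
    set α := Real.log m₁ with hαdef
    set β := Real.log m₂ with hβdef
    -- The natural rate is l = tα, so that l/α = τ₁ and l/β = τ₂.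
    have hl : 0 ≤ t * α := by positivity
    have hdim := BedfordMcMullen.dimH_recurrentSet_eq (ψ := ψ) hm₁ hm hc he h hcol hrow hl
      (fun l' hl' => BedfordMcMullen.eventually_le_exp_of_lt_decayRate hm₁ hψ (by
        rw [← hτ₁, EReal.coe_lt_coe_iff, div_lt_iff₀ hα]; exact hl'))
      (fun l' hl' => BedfordMcMullen.frequently_exp_le_of_decayRate_lt hm₁ hψ (by
        rw [← hτ₁, EReal.coe_lt_coe_iff, lt_div_iff₀ hα]; exact hl'))
    rw [← hαdef, ← hβdef] at hdim
    have e₁ : (Real.log M * (β / α) + Real.log N) / (β + t * α) =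
        (Real.log M / α + Real.log N / β) / (1 + α / β * t) := by field_simp
    have e₂ : (Real.log M + Real.log N * ((α + t * α) / β)) / (α + t * α) =
        Real.log M / α / (1 + t) + Real.log N / β := by field_simp
    have e₃ : (Real.log M + Real.log N) / (α + t * α) =
        (Real.log M / α + Real.log N / α) / (1 + t) := by field_simp
    rw [e₁, e₂, e₃] at hdim
    have hcoe : ((dimH (BedfordMcMullen.recurrentSet A ψ) : ℝ≥0∞) : EReal) =
        ((min ((Real.log M / α + Real.log N / β) / (1 + α / β * t))
          (min (Real.log M / α / (1 + t) + Real.log N / β)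
            ((Real.log M / α + Real.log N / α) / (1 + t))) : ℝ) : EReal) := by
      rw [hdim, EReal.coe_ennreal_ofReal, max_eq_left]
      refine le_min ?_ (le_min ?_ ?_) <;> positivity
    have hmin : ∀ x y : ℝ, ((min x y : ℝ) : EReal) = min (x : EReal) y := fun x y =>
      EReal.coe_strictMono.monotone.map_min
    rw [hcoe, hτ₂₁]
    simp only [Real.logb, ← hαdef, ← hβdef]
    -- The last two values differ only in log N / β against log N / (α(1 + t)), so the case
    -- hypothesis decides which is smaller.
    have hN₁ : Real.log N / α / (1 + t) = Real.log N / (α * (1 + t)) := by rw [div_div]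
    constructor
    · intro hlt
      have hlt : 1 + t < β / α := by exact_mod_cast hlt
      rw [lt_div_iff₀ hα] at hlt
      have : Real.log M / α / (1 + t) + Real.log N / β ≤
          (Real.log M / α + Real.log N / α) / (1 + t) := by
        rw [add_div, hN₁]
        gcongr
        linarith
      rw [min_eq_left this]
      simp only [hmin, EReal.coe_div, EReal.coe_add, EReal.coe_mul, EReal.coe_one]
    · intro hle
      have hle : β / α ≤ 1 + t := by exact_mod_cast hle
      rw [div_le_iff₀ hα] at hle
      have : (Real.log M / α + Real.log N / α) / (1 + t) ≤
          Real.log M / α / (1 + t) + Real.log N / β := by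
        rw [add_div, hN₁]
        gcongr
        linarith
      rw [min_eq_right this]
      simp only [hmin, EReal.coe_div, EReal.coe_add, EReal.coe_mul, EReal.coe_one]
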